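/- All graphs are finite and simple. For $i\ge 2$, the bone $B_i$ is the tree obtained from a path on $i$ vertices by attaching two pendent edges to each of its two end vertices. The local independence number $\alpha_l(G)$ is the largest integer $t$ such that $G$ contains an induced subgraph isomorphic to the star $K_{1,t}$. The deficiency $\mathrm{def}(G)$ is the number of vertices of $G$ not saturated by a maximum matching. Theorem. Let $m\ge 3$ be an odd integer and let $A$ be a set of odd positive integers such that for all $p,q\in A$ (possibly equal) with $p,q\ge m$, neither $p+q+1$ nor $p+q-1$ belongs to $A$. Let $n>3$ be an integer, and let $G$ be a connected graph with $\alpha_l(G)<n$ such that, for every $i\ge 2$, if $G$ contains an induced subgraph isomorphic to $B_i$ then $i\in A$. Then $$\mathrm{def}(G)\le m(n-3)(n-2)^{\frac{m-3}{2}}+1 .$$ Furthermore, if $m=3$, then $\mathrm{def}(G)\le 2n-5$. -/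

import Mathlib

namespace SimpleGraph

/-- The bone `B_i`: the tree obtained from the path `P_i` on `i` vertices (the vertices `inl a`)
by attaching two pendent edges to each of its two end vertices.  The leaves `inr (false, _)` are
attached to the first vertex of the path and the leaves `inr (true, _)` to the last one.
(Only `2 ≤ i` is meaningful.) -/
def bone (i : ℕ) : SimpleGraph (Fin i ⊕ Bool × Bool) where
  Adj
    | .inl a, .inl b => (pathGraph i).Adj a b
    | .inl a, .inr (e, _) => if e then a.val + 1 = i else a.val = 0
    | .inr (e, _), .inl a => if e then a.val + 1 = i else a.val = 0
    | .inr _, .inr _ => False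
  symm := ⟨by
    rintro (a | ⟨e, k⟩) (b | ⟨f, l⟩) h
    · exact h.symm
    · exact h
    · exact h
    · exact h⟩
  loopless := ⟨by
    rintro (a | ⟨e, k⟩) h
    · exact h.ne rfl
    · exact h⟩

variable {V : Type*}

/-- `G` belongs to the family of connected graphs all of whose bones (that is, induced subgraphs
isomorphic to some `B_i`, `i ≥ 2`) are of the form `B_i` with `i ∈ A`. -/
def AdmitsOnlyBones (G : SimpleGraph V) (A : Set ℕ) : Prop :=
  G.Connected ∧ ∀ i : ℕ, 2 ≤ i → (bone i).IsIndContained G → i ∈ A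

/-- The local independence number of a (finite, nonempty) graph: the largest `t` such that `G`
contains an induced subgraph isomorphic to the star `K_{1,t}`. -/
noncomputable def localIndepNum (G : SimpleGraph V) : ℕ :=
  sSup {t : ℕ | (completeBipartiteGraph (Fin 1) (Fin t)).IsIndContained G}

/-- A maximum matching: a matching with the largest possible number of edges. -/
def IsMaximumMatching (G : SimpleGraph V) (M : G.Subgraph) : Prop :=
  M.IsMatching ∧ ∀ M' : G.Subgraph, M'.IsMatching → M'.edgeSet.ncard ≤ M.edgeSet.ncard

/-- The deficiency of a finite graph: the number of vertices not saturated by a maximum matching.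
All maximum matchings leave the same number of vertices unsaturated, see
`deficiency_eq_of_isMaximumMatching`, so the infimum is over a one-element set. -/
noncomputable def deficiency (G : SimpleGraph V) : ℕ :=
  sInf {k : ℕ | ∃ M : G.Subgraph, IsMaximumMatching G M ∧ (M.vertsᶜ).ncard = k}

lemma ncard_verts_of_isMatching [Finite V] {G : SimpleGraph V} {M : G.Subgraph}
    (h : M.IsMatching) : M.verts.ncard = 2 * M.edgeSet.ncard := by
  classical
  have := Fintype.ofFinite V
  have h1 : Fintype.card M.verts = 2 * M.coe.edgeFinset.card := by
    rw [← M.coe.sum_degrees_eq_twice_card_edges, ← Finset.card_univ, Finset.card_eq_sum_ones]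
    refine Finset.sum_congr (by ext; simp) fun v _ => ?_
    rw [Subgraph.coe_degree]
    convert (Subgraph.isMatching_iff_forall_degree.1 h v v.2).symm
  have h3 : M.edgeSet = (Sym2.map ((↑) : M.verts → V)) '' M.coe.edgeSet := by
    ext e
    induction e with | _ x y
    constructor
    · intro hxy
      exact ⟨s(⟨x, M.edge_vert hxy⟩, ⟨y, M.edge_vert hxy.symm⟩), hxy, rfl⟩
    · rintro ⟨e', he', heq⟩
      induction e' with | _ a b
      rw [← heq]
      exact he'
  rw [h3, Set.ncard_image_of_injective _ (Sym2.map.injective Subtype.val_injective),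
    ← Nat.card_coe_set_eq, Nat.card_eq_fintype_card, h1, ← coe_edgeFinset,
    Set.ncard_coe_finset]

lemma exists_isMaximumMatching [Finite V] (G : SimpleGraph V) :
    ∃ M : G.Subgraph, IsMaximumMatching G M := by
  have hne : {M : G.Subgraph | M.IsMatching}.Nonempty := ⟨⊥, by intro v hv; simp at hv⟩
  obtain ⟨M, hM, hmax⟩ :=
    Set.exists_max_image {M : G.Subgraph | M.IsMatching} (fun M => M.edgeSet.ncard)
      (Set.toFinite _) hne
  exact ⟨M, hM, hmax⟩

lemma deficiency_eq_of_isMaximumMatching [Finite V] {G : SimpleGraph V} {M : G.Subgraph}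
    (hM : IsMaximumMatching G M) : deficiency G = (M.vertsᶜ).ncard := by
  have : {k : ℕ | ∃ M : G.Subgraph, IsMaximumMatching G M ∧ (M.vertsᶜ).ncard = k} =
      {(M.vertsᶜ).ncard} := by
    ext k
    simp only [Set.mem_ofPred_eq, Set.mem_singleton_iff]
    constructor
    · rintro ⟨M', hM', rfl⟩
      have e := le_antisymm (hM.2 M' hM'.1) (hM'.2 M hM.1)
      rw [Set.ncard_compl, Set.ncard_compl, ncard_verts_of_isMatching hM.1,
        ncard_verts_of_isMatching hM'.1, e]
    · rintro rfl
      exact ⟨M, hM, rfl⟩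
  rw [deficiency, this, csInf_singleton]

end SimpleGraph

/-! By Tutte–Berge it is enough that deleting any vertex set S leaves at most |S| + K components, K
being the claimed bound (`ScatteringLE.deficiency_le`). The hypotheses pass to connected induced
subgraphs, so take a smallest counterexample, with Y representing the components, and then S as
small as possible.

Minimality forces a tree-like structure. A non-cut vertex lies in Y and its neighbours in S; beyond
every cut vertex there is a vertex carrying two leaves. Any two of the latter are at even distance,
because only bones of odd index occur, so each cut vertex has a well-defined parity of distance to
all of them. Let X be the set of even cut vertices. Then X and its complement are independent,
vertices outside X have degree at most 2 (a third neighbour would create a bone of even index), and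
|Xᶜ| > |X| + K (`IsMinScattering.exists_isBranchSet`).

It remains to bound |Xᶜ| - |X|. Take a longest alternating path whose ends carry two leaves, a
spine, on 2L + 1 vertices. For L > 0 it gives 2L + 1 ∈ A. A private neighbour of an inner vertex
yields bones of indices p, q with p + q - 1 = 2L + 1; a second link between consecutive X-vertices
yields p + q + 1 = 2L + 1. The condition on A therefore confines both to the neighbourhood of the
ends, and the X-vertices of degree at least 3 lie in two balls (`IsBranchSet.exists_centers`).
Counting edges, |Xᶜ| - |X| is at most 1 plus n - 3 times the number of these vertices, and balls
grow by a factor n - 2. For m = 3 all of X lies on the spine and a direct count is sharper. -/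

namespace SimpleGraph

/-- `a` and `b` are joined by a walk of `G` avoiding the vertex set `S`. -/
def Avoid {V : Type*} (G : SimpleGraph V) (S : Set V) (a b : V) : Prop :=
  ∃ p : G.Walk a b, ∀ v ∈ p.support, v ∉ S

/-- The vertices of `Y` lie in pairwise distinct components of `G - S`. -/
def Separates {V : Type*} (G : SimpleGraph V) (S Y : Set V) : Prop :=
  Disjoint S Y ∧ ∀ a ∈ Y, ∀ b ∈ Y, a ≠ b → ¬ G.Avoid S a b

/-- Deleting any vertex set `S` leaves at most `|S| + K` components. -/
def ScatteringLE {V : Type*} (G : SimpleGraph V) (K : ℕ) : Prop :=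
  ∀ S Y : Set V, G.Separates S Y → Y.ncard ≤ S.ncard + K

/-! ### Walks avoiding a vertex set -/

section Avoid

variable {V : Type*} {G : SimpleGraph V} {S T : Set V} {a b c v : V}

lemma Avoid.left (h : G.Avoid S a b) : a ∉ S := by
  obtain ⟨p, hp⟩ := h
  exact hp _ p.start_mem_support

lemma Avoid.right (h : G.Avoid S a b) : b ∉ S := by
  obtain ⟨p, hp⟩ := h
  exact hp _ p.end_mem_support

lemma Avoid.refl (h : a ∉ S) : G.Avoid S a a :=
  ⟨Walk.nil, by simpa using h⟩

lemma Avoid.symm (h : G.Avoid S a b) : G.Avoid S b a := by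
  obtain ⟨p, hp⟩ := h
  exact ⟨p.reverse, by simpa using hp⟩

lemma Avoid.trans (h : G.Avoid S a b) (h' : G.Avoid S b c) : G.Avoid S a c := by
  obtain ⟨p, hp⟩ := h
  obtain ⟨q, hq⟩ := h'
  refine ⟨p.append q, fun v hv => ?_⟩
  rcases (Walk.mem_support_append_iff p q).1 hv with h | h
  exacts [hp _ h, hq _ h]

lemma Avoid.mono (hST : S ⊆ T) (h : G.Avoid T a b) : G.Avoid S a b := by
  obtain ⟨p, hp⟩ := h
  exact ⟨p, fun v hv hvS => hp v hv (hST hvS)⟩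

lemma Adj.avoid (h : G.Adj a b) (ha : a ∉ S) (hb : b ∉ S) : G.Avoid S a b :=
  ⟨h.toWalk, by simp [ha, hb]⟩

lemma Connected.avoid_empty (h : G.Connected) (a b : V) : G.Avoid ∅ a b := by
  obtain ⟨p⟩ := h.preconnected a b
  exact ⟨p, by simp⟩

/-- A walk avoiding `S` either avoids `v` as well, or reaches a neighbour of `v` before `v`. -/
lemma Avoid.insert_or (h : G.Avoid S a b) (hav : a ≠ v) :
    G.Avoid (insert v S) a b ∨ v ∉ S ∧ ∃ c, G.Adj c v ∧ G.Avoid (insert v S) a c := by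
  obtain ⟨p, hp⟩ := h
  induction p with
  | nil => exact Or.inl (Avoid.refl (by simpa [hav] using hp))
  | @cons x y z hxy q ih =>
    have hx : x ∉ insert v S := by
      simp only [Set.mem_insert_iff, hav, false_or]
      exact hp x (by simp)
    by_cases hyv : y = v
    · subst hyv
      exact Or.inr ⟨hp y (by simp), x, hxy, Avoid.refl hx⟩
    · have hy : y ∉ insert v S := by
        simp only [Set.mem_insert_iff, hyv, false_or]
        exact hp y (by simp)
      have hxy' := hxy.avoid hx hy
      rcases ih hyv (fun w hw => hp w (by simp [hw])) with h | ⟨hv, c, hc, h⟩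
      · exact Or.inl (hxy'.trans h)
      · exact Or.inr ⟨hv, c, hc, hxy'.trans h⟩

/-- In a connected graph every vertex other than `v` is joined to a neighbour of `v`
by a walk avoiding `v`. -/
lemma Connected.exists_adj_avoid (hG : G.Connected) (hav : a ≠ v) :
    ∃ c, G.Adj c v ∧ G.Avoid {v} a c := by
  rcases (hG.avoid_empty a v).insert_or hav with h | ⟨-, c, hc, h⟩
  · exact absurd h.right (by simp)
  · exact ⟨c, hc, by simpa using h⟩

lemma avoid_of_seq {f : ℕ → V} {s t : ℕ} (hst : s ≤ t)
    (hadj : ∀ r, s ≤ r → r < t → G.Adj (f r) (f (r + 1)))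
    (hS : ∀ r, s ≤ r → r ≤ t → f r ∉ S) : G.Avoid S (f s) (f t) := by
  induction t, hst using Nat.le_induction with
  | base => exact Avoid.refl (hS s le_rfl le_rfl)
  | succ t hst ih =>
    exact (ih (fun r h1 h2 => hadj r h1 (by omega)) (fun r h1 h2 => hS r h1 (by omega))).trans
      ((hadj t hst (by omega)).avoid (hS t hst (by omega)) (hS (t + 1) (by omega) le_rfl))

/-- Distances add up across a cut vertex. -/
lemma Connected.dist_eq_add_of_not_avoid (hG : G.Connected) (h : ¬ G.Avoid {v} a b) :
    G.dist a b = G.dist a v + G.dist v b := by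
  classical
  refine le_antisymm hG.dist_triangle ?_
  obtain ⟨p, hp⟩ := hG.exists_walk_length_eq_dist a b
  have hv : v ∈ p.support := by
    by_contra hv
    exact h ⟨p, fun w hw hwv => hv (by rwa [Set.mem_singleton_iff.1 hwv] at hw)⟩
  have := congrArg Walk.length (p.take_spec hv)
  rw [Walk.length_append] at this
  have h1 := dist_le (p.takeUntil v hv)
  have h2 := dist_le (p.dropUntil v hv)
  omega

lemma Connected.induce_of_avoid {W : Set V} (ha : a ∈ W) (h : ∀ b ∈ W, G.Avoid Wᶜ a b) :
    (G.induce W).Connected := by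
  have key : ∀ b (hb : b ∈ W), (G.induce W).Reachable ⟨a, ha⟩ ⟨b, hb⟩ := by
    intro b hb
    obtain ⟨p, hp⟩ := h b hb
    exact ⟨p.induce W (fun x hx => by simpa using hp x hx)⟩
  have : Nonempty W := ⟨⟨a, ha⟩⟩
  exact ⟨fun x y => (key x x.2).symm.trans (key y y.2)⟩

lemma Separates.induce {Y W : Set V} (h : G.Separates S Y) :
    (G.induce W).Separates ((↑) ⁻¹' S) ((↑) ⁻¹' Y) := by
  refine ⟨h.1.preimage _, fun a ha b hb hab ⟨p, hp⟩ => ?_⟩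
  let φ : G.induce W →g G := (Embedding.induce W).toHom
  have key : G.Avoid S (φ a) (φ b) := by
    refine ⟨p.map φ, fun v hv => ?_⟩
    rw [Walk.support_map, List.mem_map] at hv
    obtain ⟨w, hw, rfl⟩ := hv
    exact hp w hw
  exact h.2 a ha b hb (fun h => hab (Subtype.ext h)) key

end Avoid

/-! ### Bones and geodesics -/

section Bones

variable {V : Type*} {G : SimpleGraph V}

/-- An induced path with two suitable extra neighbours at each end is a bone. -/
lemma bone_isIndContained {f : ℕ → V} {d : ℕ} (hd : 1 ≤ d)
    (hadj : ∀ s t, s ≤ d → t ≤ d → (G.Adj (f s) (f t) ↔ s + 1 = t ∨ t + 1 = s))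
    (hinj : ∀ s t, s ≤ d → t ≤ d → f s = f t → s = t)
    {a b c e : V} (hab : a ≠ b) (hab' : ¬ G.Adj a b) (hce : c ≠ e) (hce' : ¬ G.Adj c e)
    (ha : G.Adj (f 0) a) (hb : G.Adj (f 0) b) (hc : G.Adj (f d) c) (he : G.Adj (f d) e)
    (ha' : ∀ t, 1 ≤ t → t ≤ d → ¬ G.Adj a (f t)) (hb' : ∀ t, 1 ≤ t → t ≤ d → ¬ G.Adj b (f t))
    (hc' : ∀ t < d, ¬ G.Adj c (f t)) (he' : ∀ t < d, ¬ G.Adj e (f t))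
    (hac : ¬ G.Adj a c) (hae : ¬ G.Adj a e) (hbc : ¬ G.Adj b c) (hbe : ¬ G.Adj b e) :
    (bone (d + 1)).IsIndContained G := by
  -- A leaf lying on the path could only be `f 1`, the path neighbour of `f 0`; this is excluded by
  -- `f 2`, or by the leaf at the far end when `d = 1`.
  have left_ne : ∀ x y, G.Adj (f 0) x → (∀ t, 1 ≤ t → t ≤ d → ¬ G.Adj x (f t)) →
      G.Adj (f d) y → ¬ G.Adj x y → ∀ t ≤ d, x ≠ f t := by
    rintro x y hx hx' hy hxy t ht rfl
    have h1 := (hadj 0 t (by omega) ht).1 hx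
    obtain rfl : t = 1 := by omega
    rcases hd.eq_or_lt with rfl | hd
    · exact hxy hy
    · exact hx' 2 (by omega) (by omega) ((hadj 1 2 (by omega) (by omega)).2 (by omega))
  have right_ne : ∀ x y, G.Adj (f 0) x → G.Adj (f d) y → (∀ t < d, ¬ G.Adj y (f t)) →
      ¬ G.Adj x y → ∀ t ≤ d, y ≠ f t := by
    rintro x y hx hy hy' hxy t ht rfl
    have h1 := (hadj d t (by omega) ht).1 hy
    obtain rfl : d = t + 1 := by omega
    rcases Nat.eq_zero_or_pos t with rfl | htpos
    · exact hxy hx.symm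
    · exact hy' (t - 1) (by omega) ((hadj t (t - 1) (by omega) (by omega)).2 (by omega))
  have ha1 := left_ne a c ha ha' hc hac
  have hb1 := left_ne b c hb hb' hc hbc
  have hc1 := right_ne a c ha hc hc' hac
  have he1 := right_ne a e ha he he' hae
  have cross : ∀ x y, G.Adj (f 0) x → (∀ t < d, ¬ G.Adj y (f t)) → x ≠ y := by
    rintro x y hx hy rfl
    exact hy 0 (by omega) hx.symm
  let φ : Fin (d + 1) ⊕ Bool × Bool → V
    | .inl i => f i
    | .inr (false, false) => a
    | .inr (false, true) => b
    | .inr (true, false) => c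
    | .inr (true, true) => e
  have hφ : Function.Injective φ := by
    have hac1 := cross a c ha hc'
    have hae1 := cross a e ha he'
    have hbc1 := cross b c hb hc'
    have hbe1 := cross b e hb he'
    rintro (i | ⟨_ | _, _ | _⟩) (j | ⟨_ | _, _ | _⟩) h
    · have := hinj i j (by omega) (by omega) h
      rw [Fin.ext this]
    · exact absurd h.symm (ha1 i (by omega))
    · exact absurd h.symm (hb1 i (by omega))
    · exact absurd h.symm (hc1 i (by omega))
    · exact absurd h.symm (he1 i (by omega))
    · exact absurd h (ha1 j (by omega))
    · rfl
    · exact absurd h hab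
    · exact absurd h hac1
    · exact absurd h hae1
    · exact absurd h (hb1 j (by omega))
    · exact absurd h.symm hab
    · rfl
    · exact absurd h hbc1
    · exact absurd h hbe1
    · exact absurd h (hc1 j (by omega))
    · exact absurd h.symm hac1
    · exact absurd h.symm hbc1
    · rfl
    · exact absurd h hce
    · exact absurd h (he1 j (by omega))
    · exact absurd h.symm hae1
    · exact absurd h.symm hbe1
    · exact absurd h.symm hce
    · rfl
  have leftAdj : ∀ x, G.Adj (f 0) x → (∀ t, 1 ≤ t → t ≤ d → ¬ G.Adj x (f t)) →
      ∀ i : Fin (d + 1), G.Adj (f i) x ↔ i.val = 0 := by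
    intro x hx hx' i
    constructor
    · intro h
      by_contra h0
      exact hx' i (by omega) (by omega) h.symm
    · intro h
      rwa [h]
  have rightAdj : ∀ x, G.Adj (f d) x → (∀ t < d, ¬ G.Adj x (f t)) →
      ∀ i : Fin (d + 1), G.Adj (f i) x ↔ i.val + 1 = d + 1 := by
    intro x hx hx' i
    constructor
    · intro h
      by_contra h0
      exact hx' i (by omega) h.symm
    · intro h
      rwa [show i.val = d by omega]
  refine ⟨⟨⟨φ, hφ⟩, ?_⟩⟩
  rintro (i | ⟨_ | _, _ | _⟩) (j | ⟨_ | _, _ | _⟩)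
  · simp only [Function.Embedding.coeFn_mk, φ, bone, pathGraph_adj]
    exact hadj i j (by omega) (by omega)
  all_goals simp only [Function.Embedding.coeFn_mk, φ, bone]
  · simpa using leftAdj a ha ha' i
  · simpa using leftAdj b hb hb' i
  · simpa using rightAdj c hc hc' i
  · simpa using rightAdj e he he' i
  · simpa [G.adj_comm a] using leftAdj a ha ha' j
  · simp
  · simp [hab']
  · simp [hac]
  · simp [hae]
  · simpa [G.adj_comm b] using leftAdj b hb hb' j
  · simp [G.adj_comm b a, hab']
  · simp
  · simp [hbc]
  · simp [hbe]
  · simpa [G.adj_comm c] using rightAdj c hc hc' j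
  · simp [G.adj_comm c, hac]
  · simp [G.adj_comm c, hbc]
  · simp
  · simp [hce']
  · simpa [G.adj_comm e] using rightAdj e he he' j
  · simp [G.adj_comm e, hae]
  · simp [G.adj_comm e, hbe]
  · simp [G.adj_comm e, hce']
  · simp

/-- A geodesic between two vertices, as a sequence. -/
lemma Connected.exists_geodesic (hG : G.Connected) (u w : V) :
    ∃ f : ℕ → V, f 0 = u ∧ f (G.dist u w) = w ∧
      ∀ s t, s ≤ t → t ≤ G.dist u w → G.dist (f s) (f t) = t - s := by
  obtain ⟨p, hp⟩ := hG.exists_walk_length_eq_dist u w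
  have hle : ∀ s t, s ≤ t → t ≤ p.length → G.dist (p.getVert s) (p.getVert t) ≤ t - s := by
    intro s t hst ht
    induction t, hst using Nat.le_induction with
    | base => simp
    | succ t hst ih =>
      have h1 := hG.dist_triangle (u := p.getVert s) (v := p.getVert t) (w := p.getVert (t + 1))
      have h2 := dist_eq_one_iff_adj.2 (p.adj_getVert_succ (i := t) (by omega))
      have := ih (by omega)
      omega
  refine ⟨p.getVert, by simp, by rw [← hp]; simp, fun s t hst ht => ?_⟩
  rw [← hp] at ht
  have h1 := hle s t hst ht
  have h2 := hle 0 s (by omega) (by omega)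
  have h3 := hle t p.length ht le_rfl
  have h4 := hG.dist_triangle (u := u) (v := p.getVert s) (w := w)
  have h5 := hG.dist_triangle (u := p.getVert s) (v := p.getVert t) (w := w)
  simp only [Walk.getVert_zero, Walk.getVert_length] at h2 h3
  omega

lemma geodesic_adj_iff {f : ℕ → V} {d : ℕ}
    (hf : ∀ s t, s ≤ t → t ≤ d → G.dist (f s) (f t) = t - s) {s t : ℕ} (hs : s ≤ d) (ht : t ≤ d) :
    G.Adj (f s) (f t) ↔ s + 1 = t ∨ t + 1 = s := by
  rw [← dist_eq_one_iff_adj]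
  rcases le_total s t with h | h
  · rw [hf s t h ht]
    omega
  · rw [dist_comm, hf t s h hs]
    omega

lemma geodesic_injOn {f : ℕ → V} {d : ℕ} (hG : G.Connected)
    (hf : ∀ s t, s ≤ t → t ≤ d → G.dist (f s) (f t) = t - s) {s t : ℕ} (hs : s ≤ d) (ht : t ≤ d)
    (hst : f s = f t) : s = t := by
  rw [← hG.dist_eq_zero_iff] at hst
  rcases le_total s t with h | h
  · rw [hf s t h ht] at hst
    omega
  · rw [dist_comm, hf t s h hs] at hst
    omega

lemma geodesic_avoid {f : ℕ → V} {d : ℕ} (hG : G.Connected)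
    (hf : ∀ s t, s ≤ t → t ≤ d → G.dist (f s) (f t) = t - s) {r s t : ℕ} (hrs : r < s)
    (hst : s ≤ t) (ht : t ≤ d) : G.Avoid {f r} (f s) (f t) := by
  refine avoid_of_seq hst (fun i h1 h2 => ?_) (fun i h1 h2 h => ?_)
  · exact (geodesic_adj_iff hf (by omega) (by omega)).2 (Or.inl rfl)
  · have := geodesic_injOn hG hf (by omega) (by omega) h
    omega

end Bones

/-! ### The Tutte–Berge bound -/

section Deficiency

variable {V : Type*}

lemma deficiency_le_of_isMatching [Finite V] {G : SimpleGraph V} {M : G.Subgraph}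
    (hM : M.IsMatching) : G.deficiency ≤ (M.vertsᶜ).ncard := by
  obtain ⟨M₀, hM₀⟩ := exists_isMaximumMatching G
  rw [deficiency_eq_of_isMaximumMatching hM₀, Set.ncard_compl, Set.ncard_compl,
    ncard_verts_of_isMatching hM, ncard_verts_of_isMatching hM₀.1]
  have := hM₀.2 M hM
  omega

/-- A finite graph of even order without a perfect matching falls into at least `|U| + 2`
components on deletion of a suitable vertex set `U`. -/
lemma exists_separates_of_not_isPerfectMatching [Finite V] {G : SimpleGraph V}
    (hV : Even (Nat.card V)) (h : ¬ ∃ M : G.Subgraph, M.IsPerfectMatching) :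
    ∃ U Y : Set V, G.Separates U Y ∧ U.ncard + 2 ≤ Y.ncard := by
  rw [tutte] at h
  push Not at h
  obtain ⟨U, hU⟩ := h
  unfold IsTutteViolator at hU
  set D := ((⊤ : G.Subgraph).deleteVerts U).coe with hD
  set R : Set ((⊤ : G.Subgraph).deleteVerts U).verts := Quot.out '' D.oddComponents with hR
  have hrep := ConnectedComponent.Represents.image_out D.oddComponents
  have hRcard : R.ncard = D.oddComponents.ncard := hrep.ncard_eq
  have hverts : ((⊤ : G.Subgraph).deleteVerts U).verts = Uᶜ := by
    ext; simp
  -- The number of odd components has the parity of |V| - |U|, hence of |U|; so the excess over |U|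
  -- is at least 2 and not only 1.
  have hpar := D.odd_ncard_oddComponents
  have hcard : Nat.card ((⊤ : G.Subgraph).deleteVerts U).verts + U.ncard = Nat.card V := by
    rw [hverts, Nat.card_coe_set_eq, add_comm, Set.ncard_add_ncard_compl]
  refine ⟨U, (↑) '' R, ⟨?_, ?_⟩, ?_⟩
  · rw [Set.disjoint_right]
    rintro _ ⟨x, -, rfl⟩ hx
    exact absurd hx (hverts.subset x.2)
  · rintro _ ⟨x, hx, rfl⟩ _ ⟨y, hy, rfl⟩ hxy ⟨p, hp⟩
    have key : ∀ (a b : V) (p : G.Walk a b) (_ : ∀ v ∈ p.support, v ∉ U)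
        (ha : a ∈ ((⊤ : G.Subgraph).deleteVerts U).verts)
        (hb : b ∈ ((⊤ : G.Subgraph).deleteVerts U).verts), D.Reachable ⟨a, ha⟩ ⟨b, hb⟩ := by
      intro a b p
      induction p with
      | nil => intro _ _ _; exact Reachable.refl _
      | @cons u v w huv q ih =>
        intro hp ha hb
        have hv : v ∈ ((⊤ : G.Subgraph).deleteVerts U).verts := by
          rw [hverts]
          exact hp v (by simp)
        refine Reachable.trans (Adj.reachable ?_) (ih (fun x hx => hp x (by simp [hx])) hv hb)
        rw [hverts] at ha hv
        simp only [hD, Subgraph.coe_adj, Subgraph.deleteVerts_adj]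
        exact ⟨trivial, ha, trivial, hv, huv⟩
    have hreach := key _ _ p hp x.2 y.2
    obtain ⟨c, hc, rfl⟩ := hx
    obtain ⟨c', hc', rfl⟩ := hy
    apply hxy
    have h1 : D.connectedComponentMk (Quot.out c) = D.connectedComponentMk (Quot.out c') :=
      ConnectedComponent.eq.2 hreach
    have h2 : ∀ c : D.ConnectedComponent, D.connectedComponentMk (Quot.out c) = c :=
      fun c => Quot.out_eq c
    rw [((h2 c).symm.trans h1).trans (h2 c')]
  · rw [Set.ncard_image_of_injective _ Subtype.val_injective, hRcard]
    rcases Nat.even_or_odd D.oddComponents.ncard with he | ho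
    · have h1 : ¬ Odd (Nat.card ((⊤ : G.Subgraph).deleteVerts U).verts) := by
        rw [← hpar]
        simpa using he
      rw [Nat.not_odd_iff_even] at h1
      grind
    · have h1 := hpar.1 ho
      grind

/-- The graph obtained from `G` by adding `d` vertices adjacent to all others. -/
def addUniversal (G : SimpleGraph V) (d : ℕ) : SimpleGraph (V ⊕ Fin d) where
  Adj x y := x ≠ y ∧ ∀ a b, x = .inl a → y = .inl b → G.Adj a b
  symm := ⟨fun _ _ h => ⟨h.1.symm, fun a b ha hb => (h.2 b a hb ha).symm⟩⟩
  loopless := ⟨fun _ h => h.1 rfl⟩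

lemma addUniversal_adj_inl {G : SimpleGraph V} {d : ℕ} {a b : V} :
    (G.addUniversal d).Adj (.inl a) (.inl b) ↔ G.Adj a b := by
  constructor
  · exact fun h => h.2 a b rfl rfl
  · intro h
    refine ⟨fun hab => h.ne (Sum.inl_injective hab), ?_⟩
    rintro _ _ ⟨⟩ ⟨⟩
    exact h

/-- Restrict the perfect matching to `V`: each vertex left uncovered has its own partner among the
`d` added ones. -/
lemma deficiency_le_of_addUniversal [Finite V] {G : SimpleGraph V} {d : ℕ}
    {M : (G.addUniversal d).Subgraph} (hM : M.IsPerfectMatching) : G.deficiency ≤ d := by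
  rw [Subgraph.isPerfectMatching_iff] at hM
  let M' : G.Subgraph :=
    { verts := {v | ∃ w, M.Adj (.inl v) (.inl w)}
      Adj := fun v w => M.Adj (.inl v) (.inl w)
      adj_sub := fun h => addUniversal_adj_inl.1 h.adj_sub
      edge_vert := fun h => ⟨_, h⟩
      symm := ⟨fun _ _ h => h.symm⟩ }
  have hM' : M'.IsMatching := by
    rintro v ⟨w, hw⟩
    refine ⟨w, hw, fun w' hw' => ?_⟩
    exact Sum.inl_injective ((hM (.inl v)).unique hw' hw)
  refine (deficiency_le_of_isMatching hM').trans ?_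
  have hex : ∀ v ∈ M'.vertsᶜ, ∃ i : Fin d, M.Adj (.inl v) (.inr i) := by
    intro v hv
    obtain ⟨w | i, hw, -⟩ := hM (.inl v)
    · exact absurd ⟨w, hw⟩ hv
    · exact ⟨i, hw⟩
  rcases Nat.eq_zero_or_pos d with rfl | hd
  · rw [show M'.vertsᶜ = ∅ from
      Set.eq_empty_of_forall_notMem fun v hv => (hex v hv).choose.elim0]
    simp
  · have : Nonempty (Fin d) := ⟨⟨0, hd⟩⟩
    choose! f hf using hex
    have : Set.InjOn f M'.vertsᶜ := by
      intro v hv w hw hvw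
      have h1 := hf v hv
      have h2 := hf w hw
      rw [hvw] at h1
      exact Sum.inl_injective ((hM (.inr (f w))).unique h1.symm h2.symm)
    have := Set.ncard_le_ncard_of_injOn f (t := Set.univ) (fun _ _ => Set.mem_univ _) this
    simpa using this

/-- The nontrivial half of the Tutte–Berge formula. -/
lemma ScatteringLE.deficiency_le [Finite V] {G : SimpleGraph V} {K : ℕ} (hK : 1 ≤ K)
    (h : G.ScatteringLE K) : G.deficiency ≤ K := by
  -- One of `K` and `K - 1` makes the order even. If it is `K - 1`, the excess 2 in
  -- `exists_separates_of_not_isPerfectMatching` makes up for the missing vertex.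
  obtain ⟨d, hdK, hKd, hd⟩ : ∃ d, d ≤ K ∧ K ≤ d + 1 ∧ Even (Nat.card V + d) := by
    by_cases hp : Even (Nat.card V + K)
    · exact ⟨K, le_rfl, by omega, hp⟩
    · exact ⟨K - 1, by omega, by omega, by grind⟩
  by_cases hM : ∃ M : (G.addUniversal d).Subgraph, M.IsPerfectMatching
  · obtain ⟨M, hM⟩ := hM
    exact (deficiency_le_of_addUniversal hM).trans hdK
  exfalso
  obtain ⟨U, Y, hUY, hcard⟩ :=
    exists_separates_of_not_isPerfectMatching (by simpa [Nat.card_sum] using hd) hM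
  -- An added vertex outside `U` would connect all that remains, whereas `Y` has two separated
  -- points.
  by_cases hU : ∀ i, Sum.inr i ∈ U
  · have hY : Y = Sum.inl '' (Sum.inl ⁻¹' Y) := by
      symm
      rw [Set.image_preimage_eq_iff]
      rintro (v | i) hv
      · exact ⟨v, rfl⟩
      · exact absurd hv (Set.disjoint_left.1 hUY.1 (hU i))
    have hU' : U = Sum.inl '' (Sum.inl ⁻¹' U) ∪ Set.range Sum.inr := by
      ext (v | i) <;> simp [hU]
    have hsep : G.Separates (Sum.inl ⁻¹' U) (Sum.inl ⁻¹' Y) := by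
      refine ⟨hUY.1.preimage _, fun a ha b hb hab ⟨p, hp⟩ => ?_⟩
      let φ : G →g G.addUniversal d := ⟨Sum.inl, fun h => addUniversal_adj_inl.2 h⟩
      refine hUY.2 _ ha _ hb (fun h => hab (Sum.inl_injective h)) ?_
      have : (G.addUniversal d).Avoid U (φ a) (φ b) := by
        refine ⟨p.map φ, fun v hv => ?_⟩
        rw [Walk.support_map, List.mem_map] at hv
        obtain ⟨w, hw, rfl⟩ := hv
        exact hp w hw
      exact this
    have h1 := h _ _ hsep
    have h2 : U.ncard = (Sum.inl ⁻¹' U : Set V).ncard + d := by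
      conv_lhs => rw [hU']
      rw [Set.ncard_union_eq, Set.ncard_image_of_injective _ Sum.inl_injective, ← Set.image_univ,
        Set.ncard_image_of_injective _ Sum.inr_injective]
      · simp
      · rw [Set.disjoint_left]
        rintro _ ⟨v, -, rfl⟩ ⟨i, hi⟩
        simp at hi
    have h3 : Y.ncard = (Sum.inl ⁻¹' Y : Set V).ncard := by
      conv_lhs => rw [hY]
      rw [Set.ncard_image_of_injective _ Sum.inl_injective]
    omega
  · push Not at hU
    obtain ⟨i, hi⟩ := hU
    obtain ⟨a, ha, b, hb, hab⟩ := (Set.one_lt_ncard (Set.toFinite Y)).1 (by omega)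
    refine hUY.2 a ha b hb hab ?_
    have key : ∀ a ∈ Y, (G.addUniversal d).Avoid U a (.inr i) := by
      intro a ha
      have haU : a ∉ U := Set.disjoint_right.1 hUY.1 ha
      by_cases h : a = .inr i
      · rw [h]; exact Avoid.refl hi
      · refine Adj.avoid ⟨h, ?_⟩ haU hi
        rintro _ _ - ⟨⟩
    exact (key a ha).trans (key b hb).symm

end Deficiency

/-! ### Minimal counterexamples -/

section MinScattering

variable {V : Type*}

/-- `q` is a leaf with neighbour `v`. -/
def IsLeafAt (G : SimpleGraph V) (q v : V) : Prop :=
  G.Adj v q ∧ ∀ u, G.Adj q u → u = v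

/-- `v` carries at least two leaves. -/
def HasTwoLeaves (G : SimpleGraph V) (v : V) : Prop :=
  ∃ p q, p ≠ q ∧ G.IsLeafAt p v ∧ G.IsLeafAt q v

/-- Deleting `v` separates two of the remaining vertices. -/
def IsCutVertex (G : SimpleGraph V) (v : V) : Prop :=
  ∃ a b, a ≠ v ∧ b ≠ v ∧ ¬ G.Avoid {v} a b

lemma IsLeafAt.not_avoid {G : SimpleGraph V} {q v w : V} (h : G.IsLeafAt q v) (hw : w ≠ q) :
    ¬ G.Avoid {v} q w := by
  rintro ⟨p, hp⟩
  cases p with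
  | nil => exact hw rfl
  | @cons _ u _ hu r =>
    obtain rfl := h.2 u hu
    exact hp u (by simp) rfl

lemma IsLeafAt.ne_of_adj {G : SimpleGraph V} {q v w a b : V} (h : G.IsLeafAt q v)
    (ha : G.Adj w a) (hb : G.Adj w b) (hab : a ≠ b) : w ≠ q := by
  rintro rfl
  exact hab ((h.2 a ha).trans (h.2 b hb).symm)

/-- The walk stays in the component of `a` in `G - v`, which does not contain `u`. -/
lemma Avoid.of_not_avoid {G : SimpleGraph V} {v u a b : V} (hab : G.Avoid {v} a b)
    (hav : a ≠ v) (hau : ¬ G.Avoid {v} a u) : G.Avoid {u} a b := by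
  have hne : a ≠ u := by
    rintro rfl
    exact hau (Avoid.refl hav)
  rcases hab.insert_or hne with h | ⟨hu, c, hc, h⟩
  · exact h.mono (by simp)
  · have h' : G.Avoid {v} a c := h.mono (by simp)
    exact absurd (h'.trans (hc.avoid h'.right hu)) hau

lemma IsCutVertex.exists_not_avoid {G : SimpleGraph V} {v : V} (h : G.IsCutVertex v) (a : V) :
    ∃ b, b ≠ v ∧ ¬ G.Avoid {v} a b := by
  obtain ⟨x, y, hx, hy, hxy⟩ := h
  by_cases hax : G.Avoid {v} a x
  · exact ⟨y, hy, fun hay => hxy (hax.symm.trans hay)⟩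
  · exact ⟨x, hx, hax⟩

lemma HasTwoLeaves.isCutVertex {G : SimpleGraph V} {v : V} (h : G.HasTwoLeaves v) :
    G.IsCutVertex v := by
  obtain ⟨p, q, hpq, hp, hq⟩ := h
  exact ⟨p, q, hp.1.ne', hq.1.ne', hp.not_avoid hpq.symm⟩

/-- The distance from `u` to a vertex with two leaves is even when all bones are odd and `u` has
two neighbours that can serve as the leaves of a bone. -/
lemma even_dist_of_bones {G : SimpleGraph V} (hG : G.Connected)
    (hbones : ∀ i, 2 ≤ i → (bone i).IsIndContained G → Odd i) {u e a b : V}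
    (he : G.HasTwoLeaves e) (hue : u ≠ e) (hab : a ≠ b) (hab' : ¬ G.Adj a b)
    (ha : G.Adj u a) (hb : G.Adj u b) (hae : a ≠ e) (hbe : b ≠ e)
    (hoff : ∀ f : ℕ → V, f 0 = u → f (G.dist u e) = e →
      (∀ s t, s ≤ t → t ≤ G.dist u e → G.dist (f s) (f t) = t - s) →
      ∀ t, 1 ≤ t → t ≤ G.dist u e → ¬ G.Adj a (f t) ∧ ¬ G.Adj b (f t)) :
    Even (G.dist u e) := by
  obtain ⟨f, hf0, hfd, hf⟩ := hG.exists_geodesic u e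
  have hoff' := hoff f hf0 hfd hf
  obtain ⟨p, q, hpq, hp, hq⟩ := he
  have hd : 1 ≤ G.dist u e := hG.pos_dist_of_ne hue
  have hleaf : ∀ x, G.IsLeafAt x e → ∀ t < G.dist u e, ¬ G.Adj x (f t) := by
    intro x hx t ht hxt
    have h1 := hx.2 _ hxt
    rw [← hfd] at h1
    have := geodesic_injOn hG hf (by omega) le_rfl h1
    omega
  have h := bone_isIndContained hd (fun s t => geodesic_adj_iff hf)
    (fun s t => geodesic_injOn hG hf) hab hab' hpq
    (fun h => hp.1.ne (hq.2 p h.symm).symm)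
    (by rwa [hf0]) (by rwa [hf0]) (by rw [hfd]; exact hp.1) (by rw [hfd]; exact hq.1)
    (fun t h1 h2 => (hoff' t h1 h2).1) (fun t h1 h2 => (hoff' t h1 h2).2)
    (hleaf p hp) (hleaf q hq)
    (fun h => hae (hp.2 a h.symm)) (fun h => hae (hq.2 a h.symm))
    (fun h => hbe (hp.2 b h.symm)) (fun h => hbe (hq.2 b h.symm))
  have := hbones _ (by omega) h
  grind

/-- After `u`, a geodesic to `e` stays in the component of `e` in `G - u`; neighbours of `u` in
other components have no neighbour on that part, so they can be the leaves of a bone of index `dist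
u e + 1`. -/
lemma even_dist_of_not_avoid {G : SimpleGraph V} (hG : G.Connected)
    (hbones : ∀ i, 2 ≤ i → (bone i).IsIndContained G → Odd i) {u e a b : V}
    (he : G.HasTwoLeaves e) (hab : a ≠ b) (hab' : ¬ G.Adj a b)
    (ha : G.Adj u a) (hb : G.Adj u b) (hae : ¬ G.Avoid {u} a e) (hbe : ¬ G.Avoid {u} b e) :
    Even (G.dist u e) := by
  rcases eq_or_ne u e with rfl | hue
  · simp
  have hne : ∀ x, G.Adj u x → ¬ G.Avoid {u} x e → x ≠ e := by
    rintro x hx hxe rfl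
    exact hxe (Avoid.refl hx.ne')
  refine even_dist_of_bones hG hbones he hue hab hab' ha hb (hne a ha hae) (hne b hb hbe) ?_
  rintro f rfl hfd hf t h1 h2
  have key : ∀ x, G.Adj (f 0) x → ¬ G.Avoid {f 0} x e → ¬ G.Adj x (f t) := by
    intro x hx hxe hxt
    have h3 := geodesic_avoid hG hf (r := 0) (s := t) (by omega) h2 le_rfl
    rw [hfd] at h3
    exact hxe ((hxt.avoid hx.ne' h3.left).trans h3)
  exact ⟨key a ha hae, key b hb hbe⟩

lemma HasTwoLeaves.even_dist {G : SimpleGraph V} (hG : G.Connected)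
    (hbones : ∀ i, 2 ≤ i → (bone i).IsIndContained G → Odd i) {e e' : V}
    (he : G.HasTwoLeaves e) (he' : G.HasTwoLeaves e') : Even (G.dist e e') := by
  obtain ⟨p, q, hpq, hp, hq⟩ := he
  obtain ⟨p', q', hpq', hp', hq'⟩ := id he'
  refine even_dist_of_not_avoid hG hbones he' hpq (fun h => hp.1.ne (hq.2 p h.symm).symm)
    hp.1 hq.1 (hp.not_avoid ?_) (hq.not_avoid ?_)
  · exact hp.ne_of_adj hp'.1 hq'.1 hpq'
  · exact hq.ne_of_adj hp'.1 hq'.1 hpq'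

/-- A connected graph that is not `ScatteringLE K`, as witnessed by `S` and `Y`, while all its
connected proper induced subgraphs are, and all of whose bones are odd. -/
structure IsMinScattering (G : SimpleGraph V) (K : ℕ) (S Y : Set V) : Prop where
  connected : G.Connected
  odd_bones : ∀ i, 2 ≤ i → (bone i).IsIndContained G → Odd i
  one_le : 1 ≤ K
  induce : ∀ W : Set V, W ≠ Set.univ → (G.induce W).Connected → (G.induce W).ScatteringLE K
  sep : G.Separates S Y
  lt : S.ncard + K < Y.ncard

namespace IsMinScattering

variable {G : SimpleGraph V} {K : ℕ} {S Y : Set V}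

lemma ncard_inter_le (h : G.IsMinScattering K S Y) {W : Set V} (hW : W ≠ Set.univ) {a : V}
    (ha : a ∈ W) (hconn : ∀ b ∈ W, G.Avoid Wᶜ a b) : (Y ∩ W).ncard ≤ (S ∩ W).ncard + K := by
  have h1 := h.induce W hW (Connected.induce_of_avoid ha hconn) _ _ h.sep.induce
  have h2 : ∀ T : Set V, ((↑) ⁻¹' T : Set W).ncard = (T ∩ W).ncard := by
    intro T
    rw [← Set.ncard_image_of_injective _ Subtype.val_injective, Subtype.image_preimage_coe,
      Set.inter_comm]
  rwa [h2, h2] at h1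

lemma exists_ne_mem (h : G.IsMinScattering K S Y) (v : V) : ∃ a ∈ Y, a ≠ v := by
  have h1 := h.one_le
  have h2 := h.lt
  exact Set.exists_ne_of_one_lt_ncard (by omega) v

variable [Finite V]

/-- Otherwise deleting `v` leaves a connected graph with all of `Y` and no more of `S`: a smaller
counterexample. -/
lemma mem_of_not_isCutVertex (h : G.IsMinScattering K S Y) {v : V} (hv : ¬ G.IsCutVertex v) :
    v ∈ Y := by
  by_contra hvY
  obtain ⟨a, -, hav⟩ := h.exists_ne_mem v
  have h1 : (Y ∩ {v}ᶜ).ncard ≤ (S ∩ {v}ᶜ).ncard + K := by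
    refine h.ncard_inter_le (fun h => ?_) (a := a) (by simpa using hav) (fun b hb => ?_)
    · have : v ∈ ({v}ᶜ : Set V) := by rw [h]; trivial
      simp at this
    · rw [compl_compl]
      by_contra hab
      exact hv ⟨a, b, hav, hb, hab⟩
  have h2 : Y ∩ {v}ᶜ = Y := by
    rw [Set.inter_eq_left]
    rintro x hx rfl
    exact hvY hx
  have h3 := Set.ncard_le_ncard (Set.inter_subset_left (s := S) (t := {v}ᶜ))
  have h4 := h.lt
  rw [h2] at h1
  omega

/-- Otherwise `u` is in the component of `v` in `G - S` and can replace `v` in `Y`; then `v` is a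
non-cut vertex outside the new `Y`. -/
lemma mem_of_adj_of_not_isCutVertex (h : G.IsMinScattering K S Y) {v u : V}
    (hv : ¬ G.IsCutVertex v) (hvu : G.Adj v u) : u ∈ S := by
  by_contra huS
  have hvY := h.mem_of_not_isCutVertex hv
  have hvS : v ∉ S := Set.disjoint_right.1 h.sep.1 hvY
  have hA := hvu.avoid hvS huS
  have huY : u ∉ Y := fun huY => h.sep.2 v hvY u huY hvu.ne hA
  have hcard : (insert u (Y \ {v})).ncard = Y.ncard := by
    rw [Set.ncard_insert_of_notMem (fun h => huY h.1), Set.ncard_sdiff_singleton_add_one hvY]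
  have h' : G.IsMinScattering K S (insert u (Y \ {v})) := by
    refine { h with sep := ⟨?_, ?_⟩, lt := by rw [hcard]; exact h.lt }
    · rw [Set.disjoint_right]
      rintro x (rfl | hx)
      · exact huS
      · exact Set.disjoint_right.1 h.sep.1 hx.1
    · rintro a (rfl | ha) b (rfl | hb) hab hab'
      · exact hab rfl
      · exact h.sep.2 v hvY b hb.1 (fun h => hb.2 h.symm) (hA.trans hab')
      · exact h.sep.2 a ha.1 v hvY ha.2 (hab'.trans hA.symm)
      · exact h.sep.2 a ha.1 b hb.1 hab hab'
  rcases h'.mem_of_not_isCutVertex hv with h1 | h1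
  · exact hvu.ne h1
  · exact h1.2 rfl

/-- No part of `G - v` consists of a single leaf while the rest of the graph is connected. -/
lemma exists_ne_not_avoid (h : G.IsMinScattering K S Y) {v a q : V} (hav : a ≠ v)
    (hqv : q ≠ v) (hq : ¬ G.IsCutVertex q) (hvq : G.Adj v q) (haq : ¬ G.Avoid {v} a q) :
    ∃ b, b ≠ v ∧ b ≠ q ∧ ¬ G.Avoid {v} a b := by
  by_contra! hcon
  have hqY := h.mem_of_not_isCutVertex hq
  have hvS := h.mem_of_adj_of_not_isCutVertex hq hvq.symm
  have hqS : q ∉ S := Set.disjoint_right.1 h.sep.1 hqY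
  have hvY : v ∉ Y := Set.disjoint_left.1 h.sep.1 hvS
  have haq' : a ≠ q := by
    rintro rfl
    exact haq (Avoid.refl hav)
  -- Deleting `q ∈ Y` together with `v ∈ S` preserves |Y| - |S|, and the rest would be connected.
  have h1 : (Y ∩ {q, v}ᶜ).ncard ≤ (S ∩ {q, v}ᶜ).ncard + K := by
    refine h.ncard_inter_le (fun h => ?_) (a := a) (by simp [hav, haq']) (fun b hb => ?_)
    · have : v ∈ ({q, v}ᶜ : Set V) := by rw [h]; trivial
      simp at this
    · rw [compl_compl]
      simp only [Set.mem_compl_iff, Set.mem_insert_iff, Set.mem_singleton_iff, not_or] at hb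
      rcases (hcon b hb.2 hb.1).insert_or haq' with h | ⟨hu, c, hc, h⟩
      · exact h
      · have h' : G.Avoid {v} a c := h.mono (by simp)
        exact absurd (h'.trans (hc.avoid h'.right hu)) haq
  have h2 : Y ∩ {q, v}ᶜ = Y \ {q} := by
    ext x
    simp only [Set.mem_inter_iff, Set.mem_compl_iff, Set.mem_insert_iff, Set.mem_singleton_iff,
      Set.mem_sdiff]
    grind
  have h3 : S ∩ {q, v}ᶜ = S \ {v} := by
    ext x
    simp only [Set.mem_inter_iff, Set.mem_compl_iff, Set.mem_insert_iff, Set.mem_singleton_iff,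
      Set.mem_sdiff]
    grind
  have h4 := Set.ncard_sdiff_singleton_add_one hqY
  have h5 := Set.ncard_sdiff_singleton_add_one hvS
  have h6 := h.lt
  rw [h2, h3] at h1
  omega

/-- Each part of `G - v` not containing `a`, together with `v`, meets the set of vertices that
carry two leaves. -/
lemma exists_hasTwoLeaves_not_avoid_of_ne (h : G.IsMinScattering K S Y) {v a : V} (hav : a ≠ v)
    (hv : G.IsCutVertex v) : ∃ e, G.HasTwoLeaves e ∧ ¬ G.Avoid {v} a e := by
  have hG := h.connected
  -- Induction on what `v` cuts off from `a`: a cut vertex `u` in there cuts off strictly less from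
  -- `v`.
  induction hn : {b | b ≠ v ∧ ¬ G.Avoid {v} a b}.ncard using Nat.strong_induction_on
    generalizing v a with
  | _ n ih =>
    by_cases hcut : ∃ u, u ≠ v ∧ ¬ G.Avoid {v} a u ∧ G.IsCutVertex u
    · obtain ⟨u, huv, hau, hu⟩ := hcut
      have hau' : a ≠ u := by
        rintro rfl
        exact hau (Avoid.refl hav)
      have hva : G.Avoid {u} v a := by
        obtain ⟨c, hc, hac⟩ := hG.exists_adj_avoid hav
        have h1 := hac.of_not_avoid hav hau
        exact (h1.trans (hc.avoid h1.right huv.symm)).symm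
      have key : ∀ b, G.Avoid {v} a b → G.Avoid {u} v b :=
        fun b hab => hva.trans (hab.of_not_avoid hav hau)
      obtain ⟨e, he, hve⟩ := ih _ (by
        rw [← hn]
        refine Set.ncard_lt_ncard ⟨?_, fun hsub => ?_⟩
        · rintro b ⟨hbu, hb⟩
          refine ⟨?_, fun hab => hb (key b hab)⟩
          rintro rfl
          exact hb (Avoid.refl huv.symm)
        · exact (hsub (show u ∈ _ from ⟨huv, hau⟩)).1 rfl) huv.symm hu rfl
      exact ⟨e, he, fun hae => hve (key e hae)⟩
    -- Now all vertices cut off are non-cut vertices, so they lie in `Y` and their neighbours in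
    -- `S`. Hence no two are adjacent, and each is a leaf at `v`.
    · push Not at hcut
      have hleaf : ∀ q, q ≠ v → ¬ G.Avoid {v} a q → G.IsLeafAt q v := by
        intro q hqv haq
        have hq := hcut q hqv haq
        have hN : ∀ u, G.Adj q u → u = v := by
          intro u hqu
          by_contra huv
          have h1 : ¬ G.Avoid {v} a u := fun hau =>
            haq (hau.trans (hqu.symm.avoid huv hqv))
          exact Set.disjoint_left.1 h.sep.1 (h.mem_of_adj_of_not_isCutVertex hq hqu)
            (h.mem_of_not_isCutVertex (hcut u huv h1))
        obtain ⟨c, hc, -⟩ := hG.exists_adj_avoid hqv.symm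
        exact ⟨hN c hc.symm ▸ hc, hN⟩
      obtain ⟨q, hqv, haq⟩ := hv.exists_not_avoid a
      have hq := hleaf q hqv haq
      obtain ⟨b, hbv, hbq, hab⟩ := h.exists_ne_not_avoid hav hqv (hcut q hqv haq) hq.1 haq
      -- The vertex `v` itself qualifies, since no walk ending at `v` avoids it.
      exact ⟨v, ⟨b, q, hbq, hleaf b hbv hab, hq⟩, fun h => h.right rfl⟩

lemma exists_hasTwoLeaves_not_avoid (h : G.IsMinScattering K S Y) {v : V}
    (hv : G.IsCutVertex v) (a : V) : ∃ e, G.HasTwoLeaves e ∧ ¬ G.Avoid {v} a e := by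
  rcases eq_or_ne a v with rfl | hav
  · obtain ⟨b, -, hb, -⟩ := id hv
    obtain ⟨e, he, -⟩ := h.exists_hasTwoLeaves_not_avoid_of_ne hb hv
    exact ⟨e, he, fun h => h.left rfl⟩
  · exact h.exists_hasTwoLeaves_not_avoid_of_ne hav hv

/-- If `v` separates `e` from `e'`, their even distance is the sum of the distances to `v`. If not,
compare both with a two-leaf vertex that `v` cuts off from them. -/
lemma even_dist_iff (h : G.IsMinScattering K S Y) {v e e' : V} (hv : G.IsCutVertex v)
    (he : G.HasTwoLeaves e) (he' : G.HasTwoLeaves e') :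
    Even (G.dist v e) ↔ Even (G.dist v e') := by
  have key : ∀ x y, G.HasTwoLeaves x → G.HasTwoLeaves y → ¬ G.Avoid {v} x y →
      (Even (G.dist v x) ↔ Even (G.dist v y)) := by
    intro x y hx hy hxy
    have h1 := hx.even_dist h.connected h.odd_bones hy
    rw [h.connected.dist_eq_add_of_not_avoid hxy, dist_comm, Nat.even_add] at h1
    exact h1
  by_cases hee : G.Avoid {v} e e'
  · obtain ⟨f, hf, hef⟩ := h.exists_hasTwoLeaves_not_avoid hv e
    exact (key e f he hf hef).trans (key e' f he' hf (fun h => hef (hee.trans h))).symm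
  · exact key e e' he he' hee

/-- Measured to an `f` that `v` cuts off from `u`, the two distances differ by exactly 1. -/
lemma even_dist_iff_of_adj (h : G.IsMinScattering K S Y) {u v e : V} (hu : G.IsCutVertex u)
    (hv : G.IsCutVertex v) (huv : G.Adj u v) (he : G.HasTwoLeaves e) :
    Even (G.dist u e) ↔ ¬ Even (G.dist v e) := by
  obtain ⟨f, hf, hef⟩ := h.exists_hasTwoLeaves_not_avoid hv u
  rw [h.even_dist_iff hu he hf, h.even_dist_iff hv he hf,
    h.connected.dist_eq_add_of_not_avoid hef, dist_eq_one_iff_adj.2 huv, add_comm,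
    Nat.even_add_one]

lemma exists_hasTwoLeaves (h : G.IsMinScattering K S Y) : ∃ e, G.HasTwoLeaves e := by
  by_cases hcut : ∃ v, G.IsCutVertex v
  · obtain ⟨v, hv⟩ := hcut
    obtain ⟨e, he, -⟩ := h.exists_hasTwoLeaves_not_avoid hv v
    exact ⟨e, he⟩
  · push Not at hcut
    obtain ⟨b, hbY, hba⟩ := h.exists_ne_mem h.connected.nonempty.some
    obtain ⟨c, hc, -⟩ := h.connected.exists_adj_avoid hba
    exact absurd (h.mem_of_not_isCutVertex (hcut c))
      (Set.disjoint_left.1 h.sep.1 (h.mem_of_adj_of_not_isCutVertex (hcut _) hc.symm))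

/-- If `S` is smallest possible, each of its vertices has neighbours in three components of
`G - S`. -/
lemma exists_three_adj (h : G.IsMinScattering K S Y)
    (hmin : ∀ S' Y', G.IsMinScattering K S' Y' → S.ncard ≤ S'.ncard) {v : V} (hv : v ∈ S) :
    ∃ x y z, (G.Adj v x ∧ G.Adj v y ∧ G.Adj v z) ∧ (x ∉ S ∧ y ∉ S ∧ z ∉ S) ∧
      ¬ G.Avoid S x y ∧ ¬ G.Avoid S x z ∧ ¬ G.Avoid S y z := by
  have hins : insert v (S \ {v}) = S := by
    simp [Set.insert_eq_of_mem hv]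
  have hvY : v ∉ Y := Set.disjoint_left.1 h.sep.1 hv
  -- The points whose components merge when `v` is put back. If there are at most two, dropping `v`
  -- from `S` and one of them from `Y` gives a violating pair with smaller `S`.
  set T := {y ∈ Y | G.Avoid (S \ {v}) y v} with hT
  by_cases hcard : 2 < T.ncard
  · obtain ⟨a, b, c, ha, hb, hc, hab, hac, hbc⟩ := (Set.two_lt_ncard_iff (Set.toFinite T)).1 hcard
    have key : ∀ y ∈ T, ∃ x, G.Adj v x ∧ G.Avoid S y x := by
      intro y hy
      rcases hy.2.insert_or (v := v) (fun h => hvY (h ▸ hy.1)) with h1 | ⟨-, x, hx, h1⟩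
      · exact absurd (Set.mem_insert _ _) h1.right
      · rw [hins] at h1
        exact ⟨x, hx.symm, h1⟩
    obtain ⟨x, hx, hax⟩ := key a ha
    obtain ⟨y, hy, hby⟩ := key b hb
    obtain ⟨z, hz, hcz⟩ := key c hc
    refine ⟨x, y, z, ⟨hx, hy, hz⟩, ⟨hax.right, hby.right, hcz.right⟩, fun h1 => ?_, fun h1 => ?_,
      fun h1 => ?_⟩
    · exact h.sep.2 a ha.1 b hb.1 hab ((hax.trans h1).trans hby.symm)
    · exact h.sep.2 a ha.1 c hc.1 hac ((hax.trans h1).trans hcz.symm)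
    · exact h.sep.2 b hb.1 c hc.1 hbc ((hby.trans h1).trans hcz.symm)
  · exfalso
    obtain ⟨Y', hY', hYcard, hsub⟩ : ∃ Y' ⊆ Y, Y.ncard ≤ Y'.ncard + 1 ∧
        ∀ a ∈ Y', ∀ b ∈ Y', a ∈ T → b ∈ T → a = b := by
      rcases T.eq_empty_or_nonempty with hT0 | ⟨y₀, hy₀⟩
      · exact ⟨Y, subset_rfl, by omega, by simp [hT0]⟩
      · refine ⟨Y \ {y₀}, Set.sdiff_subset, ?_, ?_⟩
        · rw [Set.ncard_sdiff_singleton_add_one hy₀.1]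
        · intro a ha b hb haT hbT
          by_contra hab
          exact hcard ((Set.two_lt_ncard_iff (Set.toFinite T)).2
            ⟨a, b, y₀, haT, hbT, hy₀, hab, ha.2, hb.2⟩)
    have hScard := Set.ncard_sdiff_singleton_add_one hv
    have hmem : ∀ a ∈ Y, ∀ b ∈ Y, a ≠ b → G.Avoid (S \ {v}) a b → a ∈ T := by
      intro a ha b hb hab h1
      rcases h1.insert_or (v := v) (fun h => hvY (h ▸ ha)) with h2 | ⟨hvS, c, hc, h2⟩
      · rw [hins] at h2
        exact absurd h2 (h.sep.2 a ha b hb hab)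
      · have h3 : G.Avoid (S \ {v}) a c := h2.mono (Set.subset_insert _ _)
        exact ⟨ha, h3.trans (hc.avoid h3.right hvS)⟩
    have hnew : G.IsMinScattering K (S \ {v}) Y' := by
      refine { h with sep := ⟨?_, ?_⟩, lt := by have := h.lt; omega }
      · exact h.sep.1.mono Set.sdiff_subset hY'
      · intro a ha b hb hab h1
        exact hab (hsub a ha b hb (hmem a (hY' ha) b (hY' hb) hab h1)
          (hmem b (hY' hb) a (hY' ha) hab.symm h1.symm))
    have := hmin _ _ hnew
    omega

/-- Among three neighbours of `v` in distinct components of `G - S`, two are cut off by `v` from a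
common two-leaf vertex; as leaves of a bone at `v` they force the parity. -/
lemma even_dist_of_mem (h : G.IsMinScattering K S Y)
    (hmin : ∀ S' Y', G.IsMinScattering K S' Y' → S.ncard ≤ S'.ncard) {v e : V} (hv : v ∈ S)
    (he : G.HasTwoLeaves e) : G.IsCutVertex v ∧ Even (G.dist v e) := by
  have hcut : G.IsCutVertex v := by
    by_contra hcut
    exact Set.disjoint_left.1 h.sep.1 hv (h.mem_of_not_isCutVertex hcut)
  refine ⟨hcut, ?_⟩
  obtain ⟨x, y, z, ⟨hx, hy, hz⟩, ⟨hxS, hyS, hzS⟩, hxy, hxz, hyz⟩ := h.exists_three_adj hmin hv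
  have key : ∀ a b f, G.Adj v a → G.Adj v b → a ∉ S → b ∉ S → ¬ G.Avoid S a b →
      G.HasTwoLeaves f → ¬ G.Avoid {v} a f → ¬ G.Avoid {v} b f → Even (G.dist v e) := by
    intro a b f ha hb haS hbS hab hf haf hbf
    rw [h.even_dist_iff hcut he hf]
    refine even_dist_of_not_avoid h.connected h.odd_bones hf ?_ ?_ ha hb haf hbf
    · rintro rfl
      exact hab (Avoid.refl haS)
    · exact fun h => hab (h.avoid haS hbS)
  obtain ⟨f, hf, hxf⟩ := h.exists_hasTwoLeaves_not_avoid hcut x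
  by_cases hyf : G.Avoid {v} y f
  · by_cases hzf : G.Avoid {v} z f
    · obtain ⟨f', hf', hff'⟩ := h.exists_hasTwoLeaves_not_avoid hcut f
      exact key y z f' hy hz hyS hzS hyz hf' (fun h => hff' (hyf.symm.trans h))
        (fun h => hff' (hzf.symm.trans h))
    · exact key x z f hx hz hxS hzS hxz hf hxf hzf
  · exact key x y f hx hy hxS hyS hxy hf hxf hyf

end IsMinScattering

/-! ### Branch sets -/

/-- The structure of a minimal graph: `X` and its complement are independent, the vertices outside
`X` have degree at most two, and every part of `G - v`, for `v ∈ X`, leads to a vertex with two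
leaves. -/
structure IsBranchSet (G : SimpleGraph V) (X : Set V) : Prop where
  connected : G.Connected
  nonempty : X.Nonempty
  not_adj : ∀ a ∈ X, ∀ b ∈ X, ¬ G.Adj a b
  not_adj_compl : ∀ a ∉ X, ∀ b ∉ X, ¬ G.Adj a b
  degree_le_two : ∀ y ∉ X, ∀ a b c, G.Adj y a → G.Adj y b → G.Adj y c → a = b ∨ a = c ∨ b = c
  exists_not_avoid : ∀ v ∈ X, ∀ a, ∃ e ∈ X, G.HasTwoLeaves e ∧ ¬ G.Avoid {v} a e

lemma IsMinScattering.exists_isBranchSet [Finite V] {G : SimpleGraph V} {K : ℕ} {S Y : Set V}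
    (h : G.IsMinScattering K S Y)
    (hmin : ∀ S' Y', G.IsMinScattering K S' Y' → S.ncard ≤ S'.ncard) :
    ∃ X, G.IsBranchSet X ∧ X.ncard + K < Xᶜ.ncard := by
  obtain ⟨e₀, he₀⟩ := h.exists_hasTwoLeaves
  set X := {v | G.IsCutVertex v ∧ Even (G.dist v e₀)} with hX
  have hSX : S ⊆ X := fun v hv => h.even_dist_of_mem hmin hv he₀
  have hEX : ∀ e, G.HasTwoLeaves e → e ∈ X := fun e he =>
    ⟨he.isCutVertex, he.even_dist h.connected h.odd_bones he₀⟩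
  have hXX : ∀ a ∈ X, ∀ b ∈ X, ¬ G.Adj a b := fun a ha b hb hab =>
    (h.even_dist_iff_of_adj ha.1 hb.1 hab he₀).1 ha.2 hb.2
  have hYY : ∀ a ∉ X, ∀ b ∉ X, ¬ G.Adj a b := by
    intro a ha b hb hab
    by_cases hacut : G.IsCutVertex a
    · by_cases hbcut : G.IsCutVertex b
      · exact ha ⟨hacut, (h.even_dist_iff_of_adj hacut hbcut hab he₀).2 fun hbe => hb ⟨hbcut, hbe⟩⟩
      · exact ha (hSX (h.mem_of_adj_of_not_isCutVertex hbcut hab.symm))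
    · exact hb (hSX (h.mem_of_adj_of_not_isCutVertex hacut hab))
  refine ⟨X, ⟨h.connected, ⟨e₀, hEX _ he₀⟩, hXX, hYY, ?_, ?_⟩, ?_⟩
  · intro y hy a b c ha hb hc
    by_contra! hne
    have hmem : ∀ x, G.Adj y x → x ∈ X := by
      intro x hx
      by_contra hxX
      exact hYY y hy x hxX hx
    -- Beyond `a` there is an `e` at odd distance from `y`, and every geodesic to it starts with
    -- `a`; the leaves `b`, `c` at `y` would complete a bone of even index.
    obtain ⟨e, he, hye⟩ := h.exists_hasTwoLeaves_not_avoid (hmem a ha).1 y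
    have hdist := h.connected.dist_eq_add_of_not_avoid hye
    rw [dist_eq_one_iff_adj.2 ha] at hdist
    have heven := (hmem a ha).2
    rw [h.even_dist_iff (hmem a ha).1 he₀ he] at heven
    have hnot : ∀ x, G.Adj y x → x ≠ a → ¬ G.Avoid {a} x e := fun x hx hxa hxe =>
      hye ((hx.avoid ha.ne hxa).trans hxe)
    have hne' : ∀ x, G.Adj y x → x ≠ a → x ≠ e := by
      rintro x hx hxa rfl
      exact hnot x hx hxa (Avoid.refl hxa)
    have hodd : Even (G.dist y e) := by
      refine even_dist_of_bones h.connected h.odd_bones he ?_ hne.2.2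
        (hXX b (hmem b hb) c (hmem c hc)) hb hc (hne' b hb hne.1.symm) (hne' c hc hne.2.1.symm) ?_
      · rintro rfl
        exact hye (Avoid.refl ha.ne)
      · rintro f rfl hfd hf t h1 h2
        have key : ∀ x, G.Adj (f 0) x → x ≠ a → ¬ G.Adj x (f t) := by
          intro x hx hxa hxt
          have hf1 : f 1 = a := by
            by_contra hf1
            have h01 : G.Adj (f 0) (f 1) := (geodesic_adj_iff hf (by omega) (by omega)).2 (by simp)
            refine hnot (f 1) h01 hf1 ?_
            refine hfd ▸ avoid_of_seq (s := 1) (by omega) (fun r hr hr' =>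
              (geodesic_adj_iff hf (by omega) (by omega)).2 (Or.inl rfl)) (fun r hr hr' hra => ?_)
            rw [Set.mem_singleton_iff] at hra
            have h3 : G.Adj (f 0) (f r) := by rwa [hra]
            have := (geodesic_adj_iff hf (by omega) (by omega)).1 h3
            obtain rfl : r = 1 := by omega
            exact hf1 hra
          rcases h1.eq_or_lt with rfl | h1
          · exact hXX x (hmem x hx) a (hmem a ha) (hf1 ▸ hxt)
          · have h3 := geodesic_avoid h.connected hf (r := 1) h1 h2 le_rfl
            rw [hfd, hf1] at h3
            exact hnot x hx hxa ((hxt.avoid hxa h3.left).trans h3)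
        exact ⟨key b hb hne.1.symm, key c hc hne.2.1.symm⟩
    rw [hdist] at hodd
    grind
  · intro v hv a
    obtain ⟨e, he, hae⟩ := h.exists_hasTwoLeaves_not_avoid hv.1 a
    exact ⟨e, hEX e he, he, hae⟩
  -- A largest violating set inside `X` is `X` itself: adding a further `v ∈ X` splits its
  -- component, so the point of `Y'` there, if any, is replaced by two neighbours of `v`.
  · obtain ⟨S', ⟨hS'X, Y', hsep, hlt⟩, hmax⟩ := Set.exists_max_image
      {S' | S' ⊆ X ∧ ∃ Y', G.Separates S' Y' ∧ S'.ncard + K < Y'.ncard} Set.ncard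
      (Set.toFinite _) ⟨S, hSX, Y, h.sep, h.lt⟩
    have hXS' : X ⊆ S' := by
      intro v hv
      by_contra hvS'
      obtain ⟨a₀, b₀, ha₀, hb₀, hab₀⟩ := hv.1
      obtain ⟨a, hav, haa⟩ := h.connected.exists_adj_avoid ha₀
      obtain ⟨b, hbv, hbb⟩ := h.connected.exists_adj_avoid hb₀
      have hab : ¬ G.Avoid {v} a b := fun hab => hab₀ ((haa.trans hab).trans hbb.symm)
      have haX : a ∉ X := fun haX => hXX a haX v hv hav
      have hbX : b ∉ X := fun hbX => hXX b hbX v hv hbv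
      have hav' : G.Avoid S' a v := hav.avoid (fun h => haX (hS'X h)) hvS'
      have hbv' : G.Avoid S' b v := hbv.avoid (fun h => hbX (hS'X h)) hvS'
      have hne : a ≠ b := by
        rintro rfl
        exact hab (Avoid.refl hav.ne)
      set T := {y ∈ Y' | ¬ G.Avoid S' y v} with hT
      have hTcard : Y'.ncard ≤ T.ncard + 1 := by
        have h1 : (Y' \ T).ncard ≤ 1 := by
          rw [Set.ncard_le_one_iff]
          intro x y hx hy
          by_contra hxy
          have key : ∀ z ∈ Y' \ T, G.Avoid S' z v := by
            intro z hz
            by_contra hzv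
            exact hz.2 ⟨hz.1, hzv⟩
          exact hsep.2 x hx.1 y hy.1 hxy ((key x hx).trans (key y hy).symm)
        have h2 := Set.ncard_sdiff_add_ncard_of_subset (show T ⊆ Y' from fun x hx => hx.1)
        omega
      have haT : a ∉ insert b T := by
        rintro (h | h)
        exacts [hne h, h.2 hav']
      have hbT : b ∉ T := fun h => h.2 hbv'
      have hold : ∀ y ∈ T, ∀ x, G.Avoid S' x v → ¬ G.Avoid (insert v S') y x := fun y hy x hx hyx =>
        hy.2 ((hyx.mono (Set.subset_insert _ _)).trans hx)
      have hnew : G.Separates (insert v S') (insert a (insert b T)) := by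
        constructor
        · rw [Set.disjoint_right]
          rintro x (rfl | rfl | hx) (rfl | hxS)
          · exact hav.ne rfl
          · exact haX (hS'X hxS)
          · exact hbv.ne rfl
          · exact hbX (hS'X hxS)
          · exact hx.2 (Avoid.refl hvS')
          · exact Set.disjoint_left.1 hsep.1 hxS hx.1
        · rintro x (rfl | rfl | hx) y (rfl | rfl | hy) hxy hxy'
          · exact hxy rfl
          · exact hab (hxy'.mono (by simp))
          · exact hold y hy _ hav' hxy'.symm
          · exact hab (hxy'.symm.mono (by simp))
          · exact hxy rfl
          · exact hold y hy _ hbv' hxy'.symm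
          · exact hold x hx _ hav' hxy'
          · exact hold x hx _ hbv' hxy'
          · exact hsep.2 x hx.1 y hy.1 hxy (hxy'.mono (Set.subset_insert _ _))
      have hc1 : (insert v S').ncard = S'.ncard + 1 := Set.ncard_insert_of_notMem hvS'
      have hc2 : (insert a (insert b T)).ncard = T.ncard + 2 := by
        rw [Set.ncard_insert_of_notMem haT, Set.ncard_insert_of_notMem hbT]
      have := hmax (insert v S') ⟨Set.insert_subset hv hS'X, _, hnew, by omega⟩
      omega
    have h1 := Set.ncard_le_ncard hXS'
    have h2 : Y' ⊆ Xᶜ := fun y hy hyX => Set.disjoint_left.1 hsep.1 (hXS' hyX) hy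
    have h3 := Set.ncard_le_ncard h2
    omega

end MinScattering

/-! ### Spines and their bones -/

section Spine

variable {V : Type*} {G : SimpleGraph V} {X : Set V}

/-- A path `f 0, …, f (2 * L)` alternating between `X` and its complement, both of whose ends
carry two leaves. -/
structure IsSpine (G : SimpleGraph V) (X : Set V) (L : ℕ) (f : ℕ → V) : Prop where
  adj : ∀ t < 2 * L, G.Adj (f t) (f (t + 1))
  inj : ∀ s t, s ≤ 2 * L → t ≤ 2 * L → f s = f t → s = t
  mem_iff : ∀ t ≤ 2 * L, f t ∈ X ↔ Even t
  left : G.HasTwoLeaves (f 0)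
  right : G.HasTwoLeaves (f (2 * L))

/-- Among the vertices `f (2 * j)` with `a ≤ j ≤ b`, the vertex `y` is adjacent to `f (2 * i)`
only. -/
def IsPrivate (G : SimpleGraph V) (f : ℕ → V) (a b i : ℕ) (y : V) : Prop :=
  G.Adj (f (2 * i)) y ∧ ∀ j, a ≤ j → j ≤ b → G.Adj (f (2 * j)) y → j = i

lemma IsPrivate.mono {f : ℕ → V} {a b a' b' i : ℕ} {y : V} (h : G.IsPrivate f a b i y)
    (ha : a ≤ a') (hb : b' ≤ b) : G.IsPrivate f a' b' i y :=
  ⟨h.1, fun j h1 h2 => h.2 j (by omega) (by omega)⟩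

lemma IsBranchSet.mem_of_adj (h : G.IsBranchSet X) {a b : V} (ha : a ∉ X) (hab : G.Adj a b) :
    b ∈ X := by
  by_contra hb
  exact h.not_adj_compl a ha b hb hab

lemma IsBranchSet.notMem_of_adj (h : G.IsBranchSet X) {a b : V} (ha : a ∈ X) (hab : G.Adj a b) :
    b ∉ X :=
  fun hb => h.not_adj a ha b hb hab

lemma IsBranchSet.mem_seq_iff (h : G.IsBranchSet X) {f : ℕ → V} {d : ℕ} (h0 : f 0 ∈ X)
    (hadj : ∀ t < d, G.Adj (f t) (f (t + 1))) {t : ℕ} (ht : t ≤ d) : f t ∈ X ↔ Even t := by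
  induction t with
  | zero => simpa using h0
  | succ t ih =>
    rw [Nat.even_add_one, ← ih (by omega)]
    exact ⟨fun h1 h2 => h.not_adj _ h2 _ h1 (hadj t (by omega)),
      fun h1 => h.mem_of_adj h1 (hadj t (by omega))⟩

namespace IsSpine

variable {L : ℕ} {f : ℕ → V}

lemma reverse (hf : G.IsSpine X L f) : G.IsSpine X L (fun t => f (2 * L - t)) where
  adj t ht := by
    have := hf.adj (2 * L - (t + 1)) (by omega)
    rw [show 2 * L - (t + 1) + 1 = 2 * L - t by omega] at this
    exact this.symm
  inj s t hs ht hst := by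
    have := hf.inj _ _ (by omega) (by omega) hst
    omega
  mem_iff t ht := by
    rw [hf.mem_iff _ (by omega)]
    grind
  left := by simpa using hf.right
  right := by simpa using hf.left

lemma exists_isPrivate_of_hasTwoLeaves (hf : G.IsSpine X L f) {i : ℕ} (hi : i ≤ L) (h : G.HasTwoLeaves (f (2 * i))) :
    ∃ x y, x ≠ y ∧ G.IsPrivate f 0 L i x ∧ G.IsPrivate f 0 L i y := by
  obtain ⟨p, q, hpq, hp, hq⟩ := h
  have key : ∀ x, G.IsLeafAt x (f (2 * i)) → G.IsPrivate f 0 L i x := by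
    refine fun x hx => ⟨hx.1, fun j _ hj h => ?_⟩
    have := hf.inj _ _ (by omega) (by omega) (hx.2 _ h.symm)
    omega
  exact ⟨p, q, hpq, key p hp, key q hq⟩

/-- Leaving a spine at `f (2 * j)` along a disjoint path. -/
lemma append (hf : G.IsSpine X L f) {j d : ℕ} (hj : j ≤ L) {q : ℕ → V} (hq0 : q 0 = f (2 * j))
    (hadj : ∀ t < 2 * d, G.Adj (q t) (q (t + 1)))
    (hinj : ∀ s t, s ≤ 2 * d → t ≤ 2 * d → q s = q t → s = t)
    (hmem : ∀ t ≤ 2 * d, q t ∈ X ↔ Even t) (hq : G.HasTwoLeaves (q (2 * d)))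
    (hdisj : ∀ s t, 1 ≤ s → s ≤ 2 * d → t ≤ 2 * L → q s ≠ f t) :
    G.IsSpine X (j + d) (fun t => if t ≤ 2 * j then f t else q (t - 2 * j)) where
  adj t ht := by
    rcases lt_trichotomy t (2 * j) with h | h | h
    · simp only [if_pos h.le, if_pos (show t + 1 ≤ 2 * j by omega)]
      exact hf.adj t (by omega)
    · subst h
      simp only [le_refl, if_true, if_neg (show ¬ 2 * j + 1 ≤ 2 * j by omega)]
      rw [← hq0, show 2 * j + 1 - 2 * j = 0 + 1 by omega]
      exact hadj 0 (by omega)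
    · simp only [if_neg (show ¬ t ≤ 2 * j by omega), if_neg (show ¬ t + 1 ≤ 2 * j by omega)]
      rw [show t + 1 - 2 * j = t - 2 * j + 1 by omega]
      exact hadj _ (by omega)
  inj s t hs ht hst := by
    by_cases h1 : s ≤ 2 * j <;> by_cases h2 : t ≤ 2 * j <;>
      simp only [h1, h2, if_true, if_false] at hst
    · exact hf.inj s t (by omega) (by omega) hst
    · exact absurd hst.symm (hdisj _ _ (by omega) (by omega) (by omega))
    · exact absurd hst (hdisj _ _ (by omega) (by omega) (by omega))
    · have := hinj _ _ (by omega) (by omega) hst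
      omega
  mem_iff t ht := by
    by_cases h1 : t ≤ 2 * j <;> simp only [h1, if_true, if_false]
    · exact hf.mem_iff t (by omega)
    · rw [hmem _ (by omega)]
      grind
  left := by simpa using hf.left
  right := by
    rcases Nat.eq_zero_or_pos d with rfl | hd
    · simpa [← hq0] using hq
    · simp only [if_neg (show ¬ 2 * (j + d) ≤ 2 * j by omega)]
      rwa [show 2 * (j + d) - 2 * j = 2 * d by omega]

variable (hX : G.IsBranchSet X) (hf : G.IsSpine X L f)
include hX hf

/-- The only neighbours of `f (2 * i + 1)` are `f (2 * i)` and `f (2 * i + 2)`. -/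
lemma eq_of_adj_odd {i : ℕ} (hi : i < L) {x : V} (hx : G.Adj x (f (2 * i + 1))) :
    x = f (2 * i) ∨ x = f (2 * (i + 1)) := by
  have h1 : f (2 * i + 1) ∉ X := by
    rw [hf.mem_iff _ (by omega)]
    grind
  have h2 := hf.adj (2 * i) (by omega)
  have h3 := hf.adj (2 * i + 1) (by omega)
  rcases hX.degree_le_two _ h1 _ _ _ hx.symm h2.symm h3 with h | h | h
  · exact Or.inl h
  · exact Or.inr h
  · have := hf.inj _ _ (by omega) (by omega) h
    omega

lemma adj_odd_iff {i j : ℕ} (hi : i < L) (hj : j ≤ L) :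
    G.Adj (f (2 * j)) (f (2 * i + 1)) ↔ j = i ∨ j = i + 1 := by
  constructor
  · intro h
    rcases eq_of_adj_odd hX hf hi h with h | h
    · have := hf.inj _ _ (by omega) (by omega) h
      omega
    · have := hf.inj _ _ (by omega) (by omega) h
      omega
  · rintro (rfl | rfl)
    · exact hf.adj _ (by omega)
    · exact (hf.adj (2 * i + 1) (by omega)).symm

lemma adj_iff {s t : ℕ} (hs : s ≤ 2 * L) (ht : t ≤ 2 * L) :
    G.Adj (f s) (f t) ↔ s + 1 = t ∨ t + 1 = s := by
  have hmem : ∀ s t, s ≤ 2 * L → t ≤ 2 * L → G.Adj (f s) (f t) → (Even s ↔ ¬ Even t) := by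
    intro s t hs ht h
    rw [← hf.mem_iff s hs, ← hf.mem_iff t ht]
    exact ⟨fun h1 h2 => hX.not_adj _ h1 _ h2 h, fun h1 => hX.mem_of_adj h1 h.symm⟩
  rcases Nat.even_or_odd' s with ⟨i, rfl | rfl⟩ <;> rcases Nat.even_or_odd' t with ⟨j, rfl | rfl⟩
  · refine ⟨fun h => ?_, fun h => by omega⟩
    have := hmem _ _ hs ht h
    grind
  · rw [adj_odd_iff hX hf (by omega) (by omega)]
    omega
  · rw [G.adj_comm, adj_odd_iff hX hf (by omega) (by omega)]
    omega
  · refine ⟨fun h => ?_, fun h => by omega⟩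
    have := hmem _ _ hs ht h
    grind

/-- For the part of the spine ending at `f (2 * i)`, the next spine vertex is one of the two leaves
a bone needs there. -/
lemma isPrivate_next {i : ℕ} (hi : i < L) : G.IsPrivate f 0 i i (f (2 * i + 1)) :=
  ⟨hf.adj _ (by omega), fun j _ hj h => by
    have := (adj_odd_iff hX hf hi (by omega)).1 h
    omega⟩

lemma isPrivate_prev {i : ℕ} (hi : i < L) :
    G.IsPrivate f (i + 1) L (i + 1) (f (2 * i + 1)) :=
  ⟨(hf.adj (2 * i + 1) (by omega)).symm, fun j hj hj' h => by
    have := (adj_odd_iff hX hf hi (by omega)).1 h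
    omega⟩

/-- A subpath of a spine whose ends have two private neighbours each is part of a bone. -/
lemma bone_isIndContained {i j : ℕ} (hij : i < j) (hj : j ≤ L) {x y z w : V} (hxy : x ≠ y)
    (hzw : z ≠ w) (hx : G.IsPrivate f i j i x) (hy : G.IsPrivate f i j i y)
    (hz : G.IsPrivate f i j j z) (hw : G.IsPrivate f i j j w) :
    (bone (2 * (j - i) + 1)).IsIndContained G := by
  have hmem : ∀ l ≤ L, ∀ u, G.Adj (f (2 * l)) u → u ∉ X := fun l hl u hu =>
    hX.notMem_of_adj ((hf.mem_iff (2 * l) (by omega)).2 (by simp)) hu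
  have hx' := hmem i (by omega) x hx.1
  have hy' := hmem i (by omega) y hy.1
  have hz' := hmem j hj z hz.1
  have hw' := hmem j hj w hw.1
  have hpriv : ∀ l u, G.IsPrivate f i j l u → u ∉ X → ∀ t ≤ 2 * (j - i), 2 * i + t ≠ 2 * l →
      ¬ G.Adj u (f (2 * i + t)) := by
    intro l u hu huX t ht htl hut
    have h1 := (hf.mem_iff _ (by omega)).1 (hX.mem_of_adj huX hut)
    obtain ⟨s, hs⟩ := h1.two_dvd
    rw [hs] at hut
    have := hu.2 s (by omega) (by omega) hut.symm
    omega
  refine SimpleGraph.bone_isIndContained (f := fun t => f (2 * i + t)) (d := 2 * (j - i))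
    (by omega) (fun s t hs ht => ?_) (fun s t hs ht h => ?_) hxy (hX.not_adj_compl x hx' y hy')
    hzw (hX.not_adj_compl z hz' w hw') hx.1 hy.1 ?_ ?_
    (fun t h1 h2 => hpriv i x hx hx' t h2 (by omega))
    (fun t h1 h2 => hpriv i y hy hy' t h2 (by omega))
    (fun t h => hpriv j z hz hz' t (by omega) (by omega))
    (fun t h => hpriv j w hw hw' t (by omega) (by omega))
    (hX.not_adj_compl x hx' z hz') (hX.not_adj_compl x hx' w hw')
    (hX.not_adj_compl y hy' z hz') (hX.not_adj_compl y hy' w hw')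
  · rw [adj_iff hX hf (by omega) (by omega)]
    omega
  · have := hf.inj _ _ (by omega) (by omega) h
    omega
  · rw [show 2 * i + 2 * (j - i) = 2 * j by omega]
    exact hz.1
  · rw [show 2 * i + 2 * (j - i) = 2 * j by omega]
    exact hw.1

lemma bone_length_mem {A : Set ℕ} (hbones : ∀ i, 2 ≤ i → (bone i).IsIndContained G → i ∈ A)
    (hL : 0 < L) : 2 * L + 1 ∈ A := by
  obtain ⟨x, y, hxy, hx, hy⟩ := hf.exists_isPrivate_of_hasTwoLeaves (i := 0) (by omega) hf.left
  obtain ⟨z, w, hzw, hz, hw⟩ := hf.exists_isPrivate_of_hasTwoLeaves (i := L) le_rfl hf.right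
  exact hbones _ (by omega) (bone_isIndContained hX hf hL le_rfl hxy hzw hx hy hz hw)

lemma bone_left_mem {A : Set ℕ} (hbones : ∀ i, 2 ≤ i → (bone i).IsIndContained G → i ∈ A)
    {i : ℕ} (hi : 0 < i) (hiL : i ≤ L) {z w : V} (hzw : z ≠ w) (hz : G.IsPrivate f 0 i i z)
    (hw : G.IsPrivate f 0 i i w) : 2 * i + 1 ∈ A := by
  obtain ⟨x, y, hxy, hx, hy⟩ := hf.exists_isPrivate_of_hasTwoLeaves (i := 0) (by omega) hf.left
  exact hbones _ (by omega) (bone_isIndContained hX hf hi hiL hxy hzw (hx.mono le_rfl hiL)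
    (hy.mono le_rfl hiL) hz hw)

lemma bone_right_mem {A : Set ℕ} (hbones : ∀ i, 2 ≤ i → (bone i).IsIndContained G → i ∈ A)
    {i : ℕ} (hiL : i < L) {z w : V} (hzw : z ≠ w) (hz : G.IsPrivate f i L i z)
    (hw : G.IsPrivate f i L i w) : 2 * (L - i) + 1 ∈ A := by
  obtain ⟨x, y, hxy, hx, hy⟩ := hf.exists_isPrivate_of_hasTwoLeaves (i := L) le_rfl hf.right
  exact hbones _ (by omega) (bone_isIndContained hX hf hiL le_rfl hzw hxy hz hw
    (hx.mono (by omega) le_rfl) (hy.mono (by omega) le_rfl))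

/-- An inner vertex of a spine with a neighbour off the spine is close to one of the ends. -/
lemma near_end_of_isPrivate {A : Set ℕ} {k : ℕ}
    (hbones : ∀ i, 2 ≤ i → (bone i).IsIndContained G → i ∈ A)
    (hA : ∀ p ∈ A, ∀ q ∈ A, 2 * k + 1 ≤ p → 2 * k + 1 ≤ q → p + q + 1 ∉ A ∧ p + q - 1 ∉ A)
    {l : ℕ} (hl : 0 < l) (hlL : l < L) {g : V} (hg : G.IsPrivate f 0 L l g) :
    l < k ∨ L < l + k := by
  -- Otherwise `g`, with the next or previous spine vertex, completes the two halves to bones of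
  -- indices `p = 2 * l + 1` and `q = 2 * (L - l) + 1`, where `p + q - 1 = 2 * L + 1`.
  by_contra! hcon
  have hne : g ≠ f (2 * l + 1) := by
    rintro rfl
    have := hg.2 (l + 1) (by omega) (by omega) (hf.adj (2 * l + 1) (by omega)).symm
    omega
  have hne' : g ≠ f (2 * (l - 1) + 1) := by
    rintro rfl
    have := hg.2 (l - 1) (by omega) (by omega) (hf.adj (2 * (l - 1)) (by omega))
    omega
  have hprev := isPrivate_prev hX hf (i := l - 1) (by omega)
  rw [show l - 1 + 1 = l by omega] at hprev
  have h1 := bone_left_mem hX hf hbones hl hlL.le hne (hg.mono le_rfl hlL.le)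
    (isPrivate_next hX hf hlL)
  have h2 := bone_right_mem hX hf hbones hlL hne' (hg.mono (by omega) le_rfl) hprev
  refine (hA _ h1 _ h2 (by omega) (by omega)).2 ?_
  rw [show 2 * l + 1 + (2 * (L - l) + 1) - 1 = 2 * L + 1 by omega]
  exact bone_length_mem hX hf hbones (by omega)

/-- A second connection between consecutive vertices of a spine is close to one of the ends. -/
lemma near_end_of_adj_adj {A : Set ℕ} {k : ℕ} (hk : 1 ≤ k)
    (hbones : ∀ i, 2 ≤ i → (bone i).IsIndContained G → i ∈ A)
    (hA : ∀ p ∈ A, ∀ q ∈ A, 2 * k + 1 ≤ p → 2 * k + 1 ≤ q → p + q + 1 ∉ A ∧ p + q - 1 ∉ A)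
    {i : ℕ} (hiL : i < L) {y : V} (hy : y ≠ f (2 * i + 1)) (hyi : G.Adj (f (2 * i)) y)
    (hyi' : G.Adj (f (2 * (i + 1))) y) : i < k ∨ L < i + 1 + k := by
  -- Here `y` and `f (2 * i + 1)` are leaves for both the part up to `f (2 * i)` and the part from
  -- `f (2 * (i + 1))`; now `p + q + 1 = 2 * L + 1`.
  by_contra! hcon
  have hyX : y ∉ X := hX.notMem_of_adj ((hf.mem_iff (2 * i) (by omega)).2 (by simp)) hyi
  have hN : ∀ j ≤ L, G.Adj (f (2 * j)) y → j = i ∨ j = i + 1 := by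
    intro j hj hyj
    rcases hX.degree_le_two y hyX _ _ _ hyj.symm hyi.symm hyi'.symm with h | h | h
    · have := hf.inj _ _ (by omega) (by omega) h
      omega
    · have := hf.inj _ _ (by omega) (by omega) h
      omega
    · have := hf.inj _ _ (by omega) (by omega) h
      omega
  have h1 := bone_left_mem hX hf hbones (i := i) (by omega) (by omega) hy
    ⟨hyi, fun j _ hj h => by have := hN j (by omega) h; omega⟩ (isPrivate_next hX hf hiL)
  have h2 := bone_right_mem hX hf hbones (i := i + 1) (by omega) hy
    ⟨hyi', fun j hj hj' h => by have := hN j (by omega) h; omega⟩ (isPrivate_prev hX hf hiL)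
  refine (hA _ h1 _ h2 (by omega) (by omega)).1 ?_
  rw [show 2 * i + 1 + (2 * (L - (i + 1)) + 1) + 1 = 2 * L + 1 by omega]
  exact bone_length_mem hX hf hbones (by omega)

/-- A vertex of a spine bypassed by a chord has a private neighbour. -/
lemma exists_isPrivate_of_chord {i l j : ℕ} (hil : i < l) (hlj : l < j) (hjL : j ≤ L) {y : V}
    (hyi : G.Adj (f (2 * i)) y) (hyj : G.Adj (f (2 * j)) y) : ∃ g, G.IsPrivate f 0 L l g := by
  have hlX : f (2 * l) ∈ X := (hf.mem_iff (2 * l) (by omega)).2 (by simp)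
  have hyX : y ∉ X := hX.notMem_of_adj ((hf.mem_iff (2 * i) (by omega)).2 (by simp)) hyi
  have hyl : y ≠ f (2 * l) := by
    rintro rfl
    exact hyX hlX
  have hne : ∀ t ≤ 2 * L, t ≠ 2 * l → f t ∉ ({f (2 * l)} : Set V) := fun t ht htl h =>
    htl (hf.inj _ _ ht (by omega) h)
  have hleft : ∀ t < 2 * l, G.Avoid {f (2 * l)} (f 0) (f t) := fun t ht =>
    avoid_of_seq (by omega) (fun r _ _ => hf.adj r (by omega))
      (fun r _ _ => hne r (by omega) (by omega))
  have hright : ∀ s t, 2 * l < s → s ≤ t → t ≤ 2 * L → G.Avoid {f (2 * l)} (f s) (f t) :=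
    fun s t h1 h2 h3 => avoid_of_seq h2 (fun r _ _ => hf.adj r (by omega))
      (fun r _ _ => hne r (by omega) (by omega))
  have hj : G.Avoid {f (2 * l)} (f 0) (f (2 * j)) :=
    ((hleft (2 * i) (by omega)).trans (hyi.avoid (hne _ (by omega) (by omega)) hyl)).trans
      (hyj.symm.avoid hyl (hne _ (by omega) (by omega)))
  have hall : ∀ t ≤ 2 * L, t ≠ 2 * l → G.Avoid {f (2 * l)} (f 0) (f t) := by
    intro t ht htl
    rcases lt_or_gt_of_ne htl with h | h
    · exact hleft t h
    · rcases le_total t (2 * j) with h' | h'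
      · exact hj.trans (hright t (2 * j) h h' (by omega)).symm
      · exact hj.trans (hright (2 * j) t (by omega) h' ht)
  -- Because of the chord, the other spine vertices lie in one component of `G - f (2 * l)`. The
  -- private neighbour is taken towards an `e` outside it, or is a leaf if `e` is `f (2 * l)`.
  obtain ⟨e, -, he, hne'⟩ := hX.exists_not_avoid _ hlX (f 0)
  rcases eq_or_ne e (f (2 * l)) with rfl | hel
  · obtain ⟨x, -, -, hx, -⟩ := hf.exists_isPrivate_of_hasTwoLeaves (by omega) he
    exact ⟨x, hx⟩
  · obtain ⟨c, hc, hec⟩ := hX.connected.exists_adj_avoid hel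
    refine ⟨c, hc.symm, fun j' _ hj' h => ?_⟩
    by_contra hjl
    have h1 := hall (2 * j') (by omega) (by omega)
    exact hne' ((h1.trans (h.avoid h1.right hec.right)).trans hec.symm)

/-- A vertex of `X` off a longest spine is attached to an inner vertex `f (2 * j)` of the spine by
a path of length at most `min (2 * j) (2 * (L - j))`. -/
lemma exists_isPrivate_of_notMem (hmax : ∀ L' f', G.IsSpine X L' f' → L' ≤ L) {r : V}
    (hrX : r ∈ X) (hr : ∀ t ≤ 2 * L, f t ≠ r) :
    ∃ j d g, G.IsPrivate f 0 L j g ∧ G.dist (f (2 * j)) r ≤ 2 * d ∧ 0 < d ∧ d ≤ j ∧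
      j + d ≤ L := by
  have hG := hX.connected
  obtain ⟨t, ht, hmin⟩ := Set.exists_min_image {t | t ≤ 2 * L} (fun t => G.dist (f t) r)
    (Set.finite_le_nat _) ⟨0, by simp⟩
  simp only [Set.mem_ofPred_eq] at ht hmin
  -- A spine vertex outside `X` has all its neighbours on the spine, and one of them would be nearer
  -- to `r`.
  have htX : f t ∈ X := by
    rw [hf.mem_iff t ht]
    by_contra hodd
    obtain ⟨i, rfl⟩ := Nat.not_even_iff_odd.1 hodd
    obtain ⟨q, hq0, hqd, hq⟩ := hG.exists_geodesic (f (2 * i + 1)) r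
    have hpos := hG.pos_dist_of_ne (hr _ ht)
    have h1 : G.Adj (q 1) (q 0) := (geodesic_adj_iff hq (by omega) (by omega)).2 (by omega)
    rw [hq0] at h1
    have h2 := hq 1 _ hpos le_rfl
    rw [hqd] at h2
    rcases eq_of_adj_odd hX hf (by omega) h1 with h | h <;> rw [h] at h2
    · have := hmin (2 * i) (by omega)
      omega
    · have := hmin (2 * (i + 1)) (by omega)
      omega
  obtain ⟨j, rfl⟩ := ((hf.mem_iff t ht).1 htX).two_dvd
  obtain ⟨e, heX, he, hne⟩ := hX.exists_not_avoid r hrX (f (2 * j))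
  have hdist := hG.dist_eq_add_of_not_avoid hne
  obtain ⟨q, hq0, hqd, hq⟩ := hG.exists_geodesic (f (2 * j)) e
  have hpos := hG.pos_dist_of_ne (hr _ ht)
  have hqadj : ∀ t < G.dist (f (2 * j)) e, G.Adj (q t) (q (t + 1)) := fun t ht =>
    (geodesic_adj_iff hq (by omega) (by omega)).2 (Or.inl rfl)
  have hqmem : ∀ t ≤ G.dist (f (2 * j)) e, q t ∈ X ↔ Even t := fun t ht =>
    hX.mem_seq_iff (hq0 ▸ htX) hqadj ht
  obtain ⟨d, hd⟩ := ((hqmem _ le_rfl).1 (hqd.symm ▸ heX)).two_dvd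
  rw [hd] at hq hqadj hqmem hqd
  have hpath : ∀ t ≤ 2 * L, G.Avoid {r} (f (2 * j)) (f t) := by
    have h0 : ∀ t ≤ 2 * L, G.Avoid {r} (f 0) (f t) := fun t ht =>
      avoid_of_seq (by omega) (fun s _ _ => hf.adj s (by omega))
        (fun s _ _ => hr s (by omega))
    exact fun t ht' => (h0 _ ht).symm.trans (h0 t ht')
  -- A later point of `q` on the spine would be cut off from `e` by `r`, and would be nearer to `r`
  -- than the nearest spine vertex.
  have hdisj : ∀ s t, 1 ≤ s → s ≤ 2 * d → t ≤ 2 * L → q s ≠ f t := by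
    intro s t hs hsd ht' hst
    have h1 : ¬ G.Avoid {r} (q s) e := by
      rw [hst]
      exact fun h => hne ((hpath t ht').trans h)
    have h2 := hG.dist_eq_add_of_not_avoid h1
    have h3 := hq s (2 * d) hsd le_rfl
    rw [hqd] at h3
    have h4 := hmin t ht'
    rw [← hst] at h4
    omega
  have hqinj : ∀ s t, s ≤ 2 * d → t ≤ 2 * d → q s = q t → s = t :=
    fun s t => geodesic_injOn hG hq
  have hjL : j ≤ L := by omega
  -- Replacing either end of the spine by `q` gives half-lengths `j + d` and `(L - j) + d`, neither
  -- more than `L`.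
  have hlen1 := hmax _ _ (hf.append hjL hq0 hqadj hqinj hqmem (hqd.symm ▸ he) hdisj)
  have hlen2 := hmax _ _ (hf.reverse.append (j := L - j) (by omega)
    (by rw [hq0]; congr 1; omega) hqadj hqinj hqmem (hqd.symm ▸ he)
    (fun s t h1 h2 h3 => hdisj s _ h1 h2 (by omega)))
  have h01 := hqadj 0 (by omega)
  rw [hq0] at h01
  refine ⟨j, d, q 1, ⟨h01, fun i _ hi h => ?_⟩, by omega, by omega, by omega, by omega⟩
  have hq1X : q 1 ∉ X := hX.notMem_of_adj htX h01
  rcases hX.degree_le_two _ hq1X _ _ _ h.symm h01.symm (hqadj 1 (by omega)) with h | h | h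
  · have := hf.inj _ _ (by omega) (by omega) h
    omega
  · exact absurd h.symm (hdisj 2 _ (by omega) (by omega) (by omega))
  · exact absurd h.symm (hdisj 2 _ (by omega) (by omega) (by omega))

end IsSpine

lemma IsBranchSet.exists_longest_isSpine [Finite V] (hX : G.IsBranchSet X) :
    ∃ L f, G.IsSpine X L f ∧ ∀ L' f', G.IsSpine X L' f' → L' ≤ L := by
  classical
  have hbdd : ∀ L f, G.IsSpine X L f → L ≤ Nat.card V := by
    intro L f hf
    have := Nat.card_le_card_of_injective (fun i : Fin (2 * L + 1) => f i) (fun i j hij =>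
      Fin.ext (hf.inj i j (by omega) (by omega) hij))
    simp at this
    omega
  obtain ⟨v, hv⟩ := hX.nonempty
  obtain ⟨e, heX, he, -⟩ := hX.exists_not_avoid v hv v
  have h0 : ∃ f, G.IsSpine X 0 f := ⟨fun _ => e, by omega, by omega, by simp [heX], he, he⟩
  obtain ⟨f, hf⟩ := Nat.findGreatest_spec (P := fun L => ∃ f, G.IsSpine X L f)
    (Nat.zero_le (Nat.card V)) h0
  exact ⟨_, f, hf, fun L' f' hf' => Nat.le_findGreatest (hbdd L' f' hf') ⟨f', hf'⟩⟩

end Spine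

/-! ### Counting branch vertices -/

section Counting

variable {V : Type*} {G : SimpleGraph V} {X : Set V}

lemma IsSpine.dist_le (hX : G.IsBranchSet X) {L : ℕ} {f : ℕ → V} (hf : G.IsSpine X L f)
    {s t : ℕ} (hst : s ≤ t) (ht : t ≤ 2 * L) : G.dist (f s) (f t) ≤ t - s := by
  induction t, hst using Nat.le_induction with
  | base => simp
  | succ t hst ih =>
    have h1 := hX.connected.dist_triangle (u := f s) (v := f t) (w := f (t + 1))
    have h2 := dist_eq_one_iff_adj.2 (hf.adj t (by omega))
    have := ih (by omega)
    omega

/-- The vertices of `X` of degree at least three lie in two balls. -/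
lemma IsBranchSet.exists_centers [Finite V] (hX : G.IsBranchSet X) {A : Set ℕ} {k : ℕ}
    (hk : 2 ≤ k) (hbones : ∀ i, 2 ≤ i → (bone i).IsIndContained G → i ∈ A)
    (hA : ∀ p ∈ A, ∀ q ∈ A, 2 * k + 1 ≤ p → 2 * k + 1 ≤ q → p + q + 1 ∉ A ∧ p + q - 1 ∉ A) :
    ∃ c₁ ∈ X, ∃ c₂ ∈ X, ∀ r ∈ X, 2 < (G.neighborSet r).ncard →
      G.dist c₁ r ≤ 2 * (k - 1) ∨ G.dist c₂ r ≤ 2 * (k - 1) := by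
  obtain ⟨L, f, hf, hmax⟩ := hX.exists_longest_isSpine
  have hmem : ∀ i ≤ L, f (2 * i) ∈ X := fun i hi => (hf.mem_iff _ (by omega)).2 (by simp)
  have hnear : ∀ l g, 0 < l → l < L → G.IsPrivate f 0 L l g → l < k ∨ L < l + k :=
    fun l g hl hlL hg => IsSpine.near_end_of_isPrivate hX hf hbones hA hl hlL hg
  have htri : ∀ i j d r, i ≤ L → j ≤ L → G.dist (f (2 * j)) r ≤ 2 * d →
      G.dist (f (2 * i)) r ≤ 2 * ((i - j) + (j - i) + d) := by
    intro i j d r hi hj h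
    have h1 := hX.connected.dist_triangle (u := f (2 * i)) (v := f (2 * j)) (w := r)
    rcases le_total i j with hij | hij
    · have := hf.dist_le hX (s := 2 * i) (t := 2 * j) (by omega) (by omega)
      omega
    · have := hf.dist_le hX (s := 2 * j) (t := 2 * i) (by omega) (by omega)
      rw [dist_comm] at this
      omega
  -- What is attached at `f (2 * j)` reaches at most `2 * j` away, so for `j < k` it stays within `2
  -- * (k - 1)` of the first centre; the other end is symmetric.
  refine ⟨f (2 * min (k - 1) L), hmem _ (by omega), f (2 * (L - (k - 1))), hmem _ (by omega),
    fun r hr hdeg => ?_⟩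
  by_cases hrf : ∀ t ≤ 2 * L, f t ≠ r
  · obtain ⟨j, d, g, hg, hdist, hd, hdj, hdL⟩ := hf.exists_isPrivate_of_notMem hX hmax hr hrf
    rcases hnear j g (by omega) (by omega) hg with h | h
    · left
      have := htri (min (k - 1) L) j d r (by omega) (by omega) hdist
      omega
    · right
      have := htri (L - (k - 1)) j d r (by omega) (by omega) hdist
      omega
  · push Not at hrf
    obtain ⟨t, ht, rfl⟩ := hrf
    obtain ⟨j, rfl⟩ := ((hf.mem_iff t ht).1 hr).two_dvd
    -- The third neighbour may be a second link to, or a chord past, an adjacent position; this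
    -- costs one step. Position `k` is still in the ball as `k ≥ 2`.
    have key : j ≤ k ∨ L ≤ j + k := by
      by_contra! hcon
      obtain ⟨y, hy, hy1, hy2⟩ : ∃ y, G.Adj (f (2 * j)) y ∧ y ≠ f (2 * (j - 1) + 1) ∧
          y ≠ f (2 * j + 1) := by
        have h1 : ({f (2 * (j - 1) + 1), f (2 * j + 1)} : Set V).ncard <
            (G.neighborSet (f (2 * j))).ncard :=
          ((Set.ncard_insert_le _ _).trans (by simp)).trans_lt hdeg
        obtain ⟨y, hy, hy'⟩ := Set.exists_mem_notMem_of_ncard_lt_ncard h1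
        simp only [Set.mem_insert_iff, Set.mem_singleton_iff, not_or] at hy'
        exact ⟨y, hy, hy'.1, hy'.2⟩
      by_cases hpriv : G.IsPrivate f 0 L j y
      · have := hnear j y (by omega) (by omega) hpriv
        omega
      · obtain ⟨i, hi, hyi, hij⟩ : ∃ i ≤ L, G.Adj (f (2 * i)) y ∧ i ≠ j := by
          by_contra! h
          exact hpriv ⟨hy, fun i _ hi hyi => h i hi hyi⟩
        rcases lt_or_gt_of_ne hij with hij | hij
        · rcases (show i + 1 ≤ j from hij).eq_or_lt with rfl | hij
          · have := IsSpine.near_end_of_adj_adj hX hf (by omega) hbones hA (by omega)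
              (by simpa using hy1) hyi hy
            omega
          · obtain ⟨g, hg⟩ := IsSpine.exists_isPrivate_of_chord hX hf (l := j - 1) (by omega)
              (by omega) (by omega) hyi hy
            have := hnear _ g (by omega) (by omega) hg
            omega
        · rcases (show j + 1 ≤ i from hij).eq_or_lt with rfl | hij
          · have := IsSpine.near_end_of_adj_adj hX hf (by omega) hbones hA (by omega) hy2 hy hyi
            omega
          · obtain ⟨g, hg⟩ := IsSpine.exists_isPrivate_of_chord hX hf (l := j + 1) (by omega)
              (by omega) (by omega) hy hyi
            have := hnear _ g (by omega) (by omega) hg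
            omega
    rcases key with h | h
    · left
      have := htri (min (k - 1) L) j 0 (f (2 * j)) (by omega) (by omega) (by simp)
      omega
    · right
      have := htri (L - (k - 1)) j 0 (f (2 * j)) (by omega) (by omega) (by simp)
      omega

/-- The number of vertices at distance `d + 1` from `c` is bounded by the number of vertices at
distance `d` times a bound on their number of further neighbours. -/
lemma ncard_dist_succ_le [Finite V] (hG : G.Connected) {c : V} {d D : ℕ}
    (hD : ∀ v, G.dist c v = d → {w | G.Adj v w ∧ G.dist c w = d + 1}.ncard ≤ D) :
    {w | G.dist c w = d + 1}.ncard ≤ D * {v | G.dist c v = d}.ncard := by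
  classical
  have := Fintype.ofFinite V
  have hsub : {w | G.dist c w = d + 1} ⊆
      ⋃ v ∈ {v | G.dist c v = d}.toFinset, {w | G.Adj v w ∧ G.dist c w = d + 1} := by
    intro w hw
    simp only [Set.mem_ofPred_eq] at hw
    obtain ⟨f, hf0, hfd, hf⟩ := hG.exists_geodesic c w
    rw [hw] at hfd hf
    have h1 := hf 0 d (by omega) (by omega)
    have h2 : G.Adj (f d) (f (d + 1)) := (geodesic_adj_iff hf (by omega) le_rfl).2 (Or.inl rfl)
    rw [hf0] at h1
    rw [hfd] at h2
    simp only [Set.mem_iUnion]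
    exact ⟨f d, by simpa using h1, h2, hw⟩
  refine (Set.ncard_le_ncard hsub).trans ((Finset.set_ncard_biUnion_le _ _).trans ?_)
  rw [Set.ncard_eq_toFinset_card' {v | G.dist c v = d}, mul_comm, ← smul_eq_mul]
  exact Finset.sum_le_card_nsmul _ _ _ fun v hv => hD v (by simpa using hv)

lemma ncard_further_add_one_le [Finite V] (hG : G.Connected) {c v : V} {d : ℕ}
    (hv : G.dist c v = d + 1) :
    {w | G.Adj v w ∧ G.dist c w = d + 1 + 1}.ncard + 1 ≤ (G.neighborSet v).ncard := by
  obtain ⟨f, hf0, hfd, hf⟩ := hG.exists_geodesic c v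
  rw [hv] at hfd hf
  have h1 := hf 0 d (by omega) (by omega)
  have h2 : G.Adj (f (d + 1)) (f d) := (geodesic_adj_iff hf le_rfl (by omega)).2 (Or.inr rfl)
  rw [hf0] at h1
  rw [hfd] at h2
  rw [← Set.ncard_insert_of_notMem (a := f d)
    (by simp only [Set.mem_ofPred_eq, h1]; omega)]
  refine Set.ncard_le_ncard ?_
  rintro w (rfl | hw)
  exacts [h2, hw.1]

lemma IsBranchSet.ncard_neighborSet_le_two [Finite V] (hX : G.IsBranchSet X) {y : V}
    (hy : y ∉ X) : (G.neighborSet y).ncard ≤ 2 := by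
  by_contra! h
  obtain ⟨a, b, c, ha, hb, hc, hab, hac, hbc⟩ := (Set.two_lt_ncard_iff (Set.toFinite _)).1 h
  rcases hX.degree_le_two y hy a b c ha hb hc with h | h | h
  exacts [hab h, hac h, hbc h]

lemma IsBranchSet.mem_iff_even_dist (hX : G.IsBranchSet X) {c : V} (hc : c ∈ X) (v : V) :
    v ∈ X ↔ Even (G.dist c v) := by
  obtain ⟨f, hf0, hfd, hf⟩ := hX.connected.exists_geodesic c v
  have := hX.mem_seq_iff (f := f) (d := G.dist c v) (hf0.symm ▸ hc) (fun t ht =>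
    (geodesic_adj_iff hf (by omega) (by omega)).2 (Or.inl rfl)) le_rfl
  rwa [hfd] at this

/-- Balls around vertices of `X` contain few vertices of `X`. -/
lemma IsBranchSet.ncard_ball_le [Finite V] (hX : G.IsBranchSet X) {N : ℕ}
    (hN : ∀ x ∈ X, (G.neighborSet x).ncard ≤ N + 1) {c : V} (hc : c ∈ X) (k : ℕ) :
    {x | x ∈ X ∧ G.dist c x ≤ 2 * k}.ncard ≤ 1 + (N + 1) * ∑ i ∈ Finset.range k, N ^ i := by
  have hG := hX.connected
  -- Outside `X` a vertex has degree at most 2 and one neighbour nearer to `c`, so the sphere does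
  -- not grow on leaving it.
  have hodd : ∀ d, {w | G.dist c w = 2 * d + 1 + 1}.ncard ≤ {w | G.dist c w = 2 * d + 1}.ncard := by
    intro d
    rw [← one_mul {w | G.dist c w = 2 * d + 1}.ncard]
    refine ncard_dist_succ_le hG fun v hv => ?_
    have h1 := ncard_further_add_one_le hG hv
    have hvX : v ∉ X := by
      rw [hX.mem_iff_even_dist hc, hv]
      simp
    have := hX.ncard_neighborSet_le_two hvX
    omega
  have hsph : ∀ d, {w | G.dist c w = 2 * (d + 1)}.ncard ≤ (N + 1) * N ^ d := by
    intro d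
    induction d with
    | zero =>
      refine (hodd 0).trans ?_
      have h0 : {v | G.dist c v = 0} = {c} := by
        ext v
        simp [hG.dist_eq_zero_iff, eq_comm]
      have := ncard_dist_succ_le hG (c := c) (d := 0) (D := N + 1) fun v hv => by
        refine (Set.ncard_le_ncard fun w hw => hw.1).trans (hN v ?_)
        rw [hX.mem_iff_even_dist hc, hv]
        simp
      rw [h0] at this
      simpa using this
    | succ d ih =>
      refine (hodd (d + 1)).trans ?_
      have := ncard_dist_succ_le hG (c := c) (d := 2 * (d + 1)) (D := N) fun v hv => by
        have h1 := ncard_further_add_one_le hG (show G.dist c v = 2 * d + 1 + 1 by omega)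
        have := hN v ((hX.mem_iff_even_dist hc v).2 (by rw [hv]; simp))
        rw [show 2 * (d + 1) = 2 * d + 1 + 1 by omega]
        omega
      calc _ ≤ N * {v | G.dist c v = 2 * (d + 1)}.ncard := this
        _ ≤ N * ((N + 1) * N ^ d) := Nat.mul_le_mul_left _ ih
        _ = (N + 1) * N ^ (d + 1) := by ring
  induction k with
  | zero =>
    refine (Set.ncard_le_ncard (t := {c}) ?_).trans (by simp)
    rintro x ⟨-, hx⟩
    exact (hG.dist_eq_zero_iff.1 (by omega)).symm
  | succ k ih =>
    have hsub : {x | x ∈ X ∧ G.dist c x ≤ 2 * (k + 1)} ⊆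
        {x | x ∈ X ∧ G.dist c x ≤ 2 * k} ∪ {x | G.dist c x = 2 * (k + 1)} := by
      rintro x ⟨hx, hxd⟩
      have := (hX.mem_iff_even_dist hc x).1 hx
      by_cases h : G.dist c x ≤ 2 * k
      · exact Or.inl ⟨hx, h⟩
      · right
        simp only [Set.mem_ofPred_eq]
        grind
    have h1 := Set.ncard_le_ncard hsub
    have h2 := Set.ncard_union_le {x | x ∈ X ∧ G.dist c x ≤ 2 * k} {x | G.dist c x = 2 * (k + 1)}
    have h3 := hsph k
    rw [Finset.sum_range_succ, mul_add (N + 1)]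
    omega

/-- Converts the size of two balls of radius `2 * (k - 1)` into the constant of the theorem, with `2
* k + 1` as `m`. The induction needs `N ≥ 2`. -/
lemma two_mul_ball_le {N k : ℕ} (hN : 2 ≤ N) (hk : 2 ≤ k) :
    2 * (1 + (N + 1) * ∑ i ∈ Finset.range (k - 1), N ^ i) ≤ (2 * k + 1) * N ^ (k - 1) := by
  obtain ⟨k, rfl⟩ := Nat.exists_eq_add_of_le' hk
  rw [show k + 2 - 1 = k + 1 by omega]
  induction k with
  | zero => simp; omega
  | succ k ih =>
    rw [Finset.sum_range_succ]
    have h1 := ih (by omega)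
    have h2 : 2 * (k + 2) + 1 + 2 * (N + 1) ≤ (2 * (k + 1 + 2) + 1) * N := by nlinarith
    have h3 := Nat.mul_le_mul_right (N ^ (k + 1)) h2
    calc 2 * (1 + (N + 1) * (∑ i ∈ Finset.range (k + 1), N ^ i + N ^ (k + 1)))
        = 2 * (1 + (N + 1) * ∑ i ∈ Finset.range (k + 1), N ^ i) + 2 * (N + 1) * N ^ (k + 1) := by
          ring
      _ ≤ (2 * (k + 2) + 1) * N ^ (k + 1) + 2 * (N + 1) * N ^ (k + 1) := by omega
      _ = (2 * (k + 2) + 1 + 2 * (N + 1)) * N ^ (k + 1) := by ring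
      _ ≤ (2 * (k + 1 + 2) + 1) * N * N ^ (k + 1) := h3
      _ = _ := by ring

/-- Counting edges: only vertices of `X` of degree at least three contribute to the excess of
`|Xᶜ|` over `|X|`. -/
lemma IsBranchSet.ncard_compl_le [Finite V] (hX : G.IsBranchSet X) {N : ℕ} (hN1 : 1 ≤ N)
    (hN : ∀ x ∈ X, (G.neighborSet x).ncard ≤ N + 1) :
    Xᶜ.ncard ≤ X.ncard + (N - 1) * {x | x ∈ X ∧ 2 < (G.neighborSet x).ncard}.ncard + 1 := by
  classical
  have := Fintype.ofFinite V
  -- Connectedness gives |V| ≤ |E| + 1, and each edge has exactly one end in `X`, so |E| is the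
  -- degree sum over `X`.
  have h1 := hX.connected.card_vert_le_card_edgeSet_add_one
  have hbip : G.IsBipartiteWith (X.toFinset : Set V) (Xᶜ.toFinset : Set V) := by
    refine ⟨by simpa using disjoint_compl_right, fun v w hvw => ?_⟩
    simp only [Set.coe_toFinset, Set.mem_compl_iff]
    by_cases hv : v ∈ X
    · exact Or.inl ⟨hv, hX.notMem_of_adj hv hvw⟩
    · exact Or.inr ⟨hv, hX.mem_of_adj hv hvw⟩
  have h2 := isBipartiteWith_sum_degrees_eq_card_edges hbip
  have h3 : Nat.card V = X.ncard + Xᶜ.ncard := (Set.ncard_add_ncard_compl X).symm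
  rw [Nat.card_eq_fintype_card (α := G.edgeSet), ← edgeFinset_card, ← h2, h3] at h1
  have hdeg : ∀ x, G.degree x = (G.neighborSet x).ncard := by
    intro x
    rw [← card_neighborSet_eq_degree, ← Nat.card_eq_fintype_card, Nat.card_coe_set_eq]
  have h4 : ∑ x ∈ X.toFinset, G.degree x ≤
      ∑ x ∈ X.toFinset, (2 + if 2 < (G.neighborSet x).ncard then N - 1 else 0) := by
    refine Finset.sum_le_sum fun x hx => ?_
    rw [hdeg]
    have := hN x (by simpa using hx)
    split_ifs <;> omega
  rw [Finset.sum_add_distrib, ← Finset.sum_filter, Finset.sum_const, Finset.sum_const,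
    smul_eq_mul, smul_eq_mul] at h4
  have h5 : (X.toFinset.filter fun x => 2 < (G.neighborSet x).ncard).card =
      {x | x ∈ X ∧ 2 < (G.neighborSet x).ncard}.ncard := by
    rw [← Set.ncard_coe_finset]
    congr 1
    ext x
    simp
  have h6 : X.toFinset.card = X.ncard := (Set.ncard_eq_toFinset_card' X).symm
  rw [h5, h6, mul_comm _ (N - 1)] at h4
  omega

lemma IsBranchSet.ncard_compl_le_of_two_le [Finite V] (hX : G.IsBranchSet X) {A : Set ℕ} {k N : ℕ}
    (hk : 2 ≤ k) (hbones : ∀ i, 2 ≤ i → (bone i).IsIndContained G → i ∈ A)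
    (hA : ∀ p ∈ A, ∀ q ∈ A, 2 * k + 1 ≤ p → 2 * k + 1 ≤ q → p + q + 1 ∉ A ∧ p + q - 1 ∉ A)
    (hN2 : 2 ≤ N) (hN : ∀ x ∈ X, (G.neighborSet x).ncard ≤ N + 1) :
    Xᶜ.ncard ≤ X.ncard + ((2 * k + 1) * (N - 1) * N ^ (k - 1) + 1) := by
  obtain ⟨c₁, hc₁, c₂, hc₂, hR⟩ := hX.exists_centers hk hbones hA
  have h1 := hX.ncard_compl_le (by omega) hN
  have hsub : {x | x ∈ X ∧ 2 < (G.neighborSet x).ncard} ⊆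
      {x | x ∈ X ∧ G.dist c₁ x ≤ 2 * (k - 1)} ∪ {x | x ∈ X ∧ G.dist c₂ x ≤ 2 * (k - 1)} := by
    rintro x ⟨hx, hdeg⟩
    exact (hR x hx hdeg).imp (fun h => ⟨hx, h⟩) (fun h => ⟨hx, h⟩)
  have h2 := (Set.ncard_le_ncard hsub).trans (Set.ncard_union_le _ _)
  have h3 := hX.ncard_ball_le hN hc₁ (k - 1)
  have h4 := hX.ncard_ball_le hN hc₂ (k - 1)
  have h5 := two_mul_ball_le hN2 hk
  have h6 : {x | x ∈ X ∧ 2 < (G.neighborSet x).ncard}.ncard ≤ (2 * k + 1) * N ^ (k - 1) := by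
    omega
  have h7 := Nat.mul_le_mul_left (N - 1) h6
  rw [show (2 * k + 1) * (N - 1) * N ^ (k - 1) = (N - 1) * ((2 * k + 1) * N ^ (k - 1)) by ring]
  omega

/-- The case in which all bones are subject to the sum condition. -/
lemma IsBranchSet.ncard_compl_le_of_three [Finite V] (hX : G.IsBranchSet X) {A : Set ℕ} {N : ℕ}
    (hbones : ∀ i, 2 ≤ i → (bone i).IsIndContained G → i ∈ A)
    (hA : ∀ p ∈ A, ∀ q ∈ A, 3 ≤ p → 3 ≤ q → p + q + 1 ∉ A ∧ p + q - 1 ∉ A)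
    (hN1 : 1 ≤ N) (hN : ∀ x ∈ X, (G.neighborSet x).ncard ≤ N + 1) :
    Xᶜ.ncard ≤ X.ncard + (2 * N - 1) := by
  obtain ⟨L, f, hf, hmax⟩ := hX.exists_longest_isSpine
  have hA' : ∀ p ∈ A, ∀ q ∈ A, 2 * 1 + 1 ≤ p → 2 * 1 + 1 ≤ q → p + q + 1 ∉ A ∧ p + q - 1 ∉ A := hA
  have hmem : ∀ i ≤ L, f (2 * i) ∈ X := fun i hi => (hf.mem_iff _ (by omega)).2 (by simp)
  -- For `k = 1` no inner position is near an end. Nothing is then attached at inner positions, and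
  -- `X` lies on the spine.
  have hnopriv : ∀ l g, 0 < l → l < L → ¬ G.IsPrivate f 0 L l g := by
    intro l g hl hlL hg
    have := IsSpine.near_end_of_isPrivate hX hf hbones hA' hl hlL hg
    omega
  have hXf : ∀ x ∈ X, ∃ i ≤ L, x = f (2 * i) := by
    intro x hx
    by_cases hxf : ∀ t ≤ 2 * L, f t ≠ x
    · obtain ⟨j, d, g, hg, -, hd, hdj, hdL⟩ := hf.exists_isPrivate_of_notMem hX hmax hx hxf
      exact absurd hg (hnopriv j g (by omega) (by omega))
    · push Not at hxf
      obtain ⟨t, ht, rfl⟩ := hxf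
      obtain ⟨j, rfl⟩ := ((hf.mem_iff t ht).1 hx).two_dvd
      exact ⟨j, by omega, rfl⟩
  have hXcard : L + 1 ≤ X.ncard := by
    have := Set.ncard_le_ncard_of_injOn (s := Set.Iic L) (t := X) (fun i => f (2 * i))
      (fun i hi => hmem i hi) (fun i hi j hj hij => by
        have := hf.inj _ _ (by simp at hi; omega) (by simp at hj; omega) hij
        omega)
    simpa using this
  have hYsub : Xᶜ ⊆ (G.neighborSet (f (2 * 0)) ∪ G.neighborSet (f (2 * L))) ∪
      (fun i => f (2 * i + 1)) '' (Set.Ico 1 (L - 1)) := by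
    intro y hy
    by_cases h0 : G.Adj (f (2 * 0)) y
    · exact Or.inl (Or.inl h0)
    by_cases hL : G.Adj (f (2 * L)) y
    · exact Or.inl (Or.inr hL)
    right
    have hnot : ∀ i ≤ L, G.Adj (f (2 * i)) y → 0 < i ∧ i < L := by
      intro i hi h
      constructor
      · rcases Nat.eq_zero_or_pos i with rfl | h'
        · exact absurd h h0
        · exact h'
      · rcases hi.eq_or_lt with rfl | h'
        · exact absurd h hL
        · exact h'
    obtain ⟨c, hc, -⟩ := hX.connected.exists_adj_avoid (a := f 0) (v := y)
      (by rintro rfl; exact hy ((hf.mem_iff 0 (by omega)).2 (by simp)))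
    obtain ⟨j, hj, rfl⟩ := hXf c (hX.mem_of_adj hy hc.symm)
    have hj' := hnot j hj hc
    obtain ⟨i, hi, hyi, hij⟩ : ∃ i ≤ L, G.Adj (f (2 * i)) y ∧ i ≠ j := by
      by_contra! h
      exact hnopriv j y hj'.1 hj'.2 ⟨hc, fun i _ hi hyi => h i hi hyi⟩
    have hi' := hnot i hi hyi
    have key : ∀ i j, i < j → 0 < i → j < L → G.Adj (f (2 * i)) y → G.Adj (f (2 * j)) y →
        y ∈ (fun i => f (2 * i + 1)) '' (Set.Ico 1 (L - 1)) := by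
      intro i j hij hi hj hyi hyj
      rcases (show i + 1 ≤ j from hij).eq_or_lt with rfl | hij
      · refine ⟨i, by simp; omega, ?_⟩
        by_contra hne
        have := IsSpine.near_end_of_adj_adj hX hf le_rfl hbones hA' (by omega)
          (fun h => hne h.symm) hyi hyj
        omega
      · obtain ⟨g, hg⟩ := IsSpine.exists_isPrivate_of_chord hX hf (l := i + 1) (by omega)
          (by omega) (by omega) hyi hyj
        exact absurd hg (hnopriv _ g (by omega) (by omega))
    rcases lt_or_gt_of_ne hij with h | h
    · exact key i j h hi'.1 hj'.2 hyi hc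
    · exact key j i h hj'.1 hi'.2 hc hyi
  have hN0 := hN _ (hmem 0 (by omega))
  have hNL := hN _ (hmem L le_rfl)
  have h1 := (Set.ncard_le_ncard hYsub).trans (Set.ncard_union_le _ _)
  have h2 : ((fun i => f (2 * i + 1)) '' (Set.Ico 1 (L - 1))).ncard ≤ L - 1 - 1 :=
    (Set.ncard_image_le (Set.finite_Ico _ _)).trans (by simp)
  have h3 := Set.ncard_union_add_ncard_inter (G.neighborSet (f (2 * 0)))
    (G.neighborSet (f (2 * L)))
  -- For `L ≥ 2` the count is `2 * (N + 1) + (L - 2) = (L + 1) + (2 * N - 1)`. For `L = 1` the two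
  -- end neighbourhoods share `f 1`, and for `L = 0` they coincide.
  rcases Nat.lt_or_ge L 2 with hL | hL
  · have h4 : 1 ≤ L → 1 ≤ (G.neighborSet (f (2 * 0)) ∩ G.neighborSet (f (2 * L))).ncard := by
      intro hL1
      obtain rfl : L = 1 := by omega
      exact (Set.ncard_pos (Set.toFinite _)).2 ⟨f 1, hf.adj 0 (by omega), (hf.adj 1 (by omega)).symm⟩
    rcases Nat.eq_zero_or_pos L with rfl | hL1
    · rw [Set.union_self] at h1
      omega
    · have := h4 hL1
      omega
  · omega

end Counting

/-! ### Induced stars and conclusion -/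

/-- A vertex with `n` pairwise nonadjacent neighbours is the centre of an induced star. -/
lemma star_isIndContained {V : Type*} [Finite V] {G : SimpleGraph V} {v : V} {n : ℕ}
    (hn : n ≤ (G.neighborSet v).ncard)
    (hind : ∀ a b, G.Adj v a → G.Adj v b → ¬ G.Adj a b) :
    (completeBipartiteGraph (Fin 1) (Fin n)).IsIndContained G := by
  have := Fintype.ofFinite (G.neighborSet v)
  have hcard : Fintype.card (Fin n) ≤ Fintype.card (G.neighborSet v) := by
    rwa [Fintype.card_fin, ← Nat.card_eq_fintype_card, Nat.card_coe_set_eq]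
  obtain ⟨g⟩ := Function.Embedding.nonempty_of_card_le hcard
  have hinj : Function.Injective (Sum.elim (fun _ : Fin 1 => v) (fun i => (g i : V))) := by
    rintro (i | i) (j | j) h
    · rw [Subsingleton.elim i j]
    · exact absurd h (g j).2.ne
    · exact absurd h.symm (g i).2.ne
    · exact congrArg Sum.inr (g.injective (Subtype.ext h))
  refine ⟨⟨⟨_, hinj⟩, ?_⟩⟩
  rintro (i | i) (j | j)
  all_goals simp only [Function.Embedding.coeFn_mk, Sum.elim_inl, Sum.elim_inr]
  · simp
  · simp only [completeBipartiteGraph_adj, Sum.isLeft_inl, Sum.isRight_inr, and_self, true_or,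
      iff_true]
    exact (g j).2
  · simp only [completeBipartiteGraph_adj, Sum.isLeft_inl, Sum.isRight_inr, and_self, or_true,
      iff_true]
    exact (g i).2.symm
  · simp [hind _ _ (g i).2 (g j).2]

lemma IsBranchSet.ncard_neighborSet_lt {V : Type*} [Finite V] {G : SimpleGraph V} {X : Set V}
    (hX : G.IsBranchSet X) {n : ℕ}
    (hstar : ¬ (completeBipartiteGraph (Fin 1) (Fin n)).IsIndContained G) {x : V} (hx : x ∈ X) :
    (G.neighborSet x).ncard < n := by
  by_contra! h
  exact hstar (star_isIndContained h fun a b ha hb =>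
    hX.not_adj_compl a (hX.notMem_of_adj hx ha) b (hX.notMem_of_adj hx hb))

universe u

/-- The number of components left by the deletion of a vertex set is controlled by the branch sets
of the connected induced subgraphs. -/
lemma scatteringLE_of_isBranchSet {A : Set ℕ} {K n : ℕ} (hK : 1 ≤ K) (hodd : ∀ a ∈ A, Odd a)
    (hcore : ∀ {V : Type u} [Finite V] (G : SimpleGraph V) (X : Set V), G.IsBranchSet X →
      (∀ i, 2 ≤ i → (bone i).IsIndContained G → i ∈ A) →
      ¬ (completeBipartiteGraph (Fin 1) (Fin n)).IsIndContained G → Xᶜ.ncard ≤ X.ncard + K)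
    {V : Type u} [Finite V] {G : SimpleGraph V} (hG : G.Connected)
    (hbones : ∀ i, 2 ≤ i → (bone i).IsIndContained G → i ∈ A)
    (hstar : ¬ (completeBipartiteGraph (Fin 1) (Fin n)).IsIndContained G) :
    G.ScatteringLE K := by
  induction hc : Nat.card V using Nat.strong_induction_on generalizing V with
  | _ c ih =>
    by_contra hcon
    unfold ScatteringLE at hcon
    push Not at hcon
    obtain ⟨S₀, Y₀, hsep, hlt⟩ := hcon
    have hmin : G.IsMinScattering K S₀ Y₀ := by
      refine ⟨hG, fun i hi h => hodd i (hbones i hi h), hK, fun W hW hWconn => ?_, hsep, hlt⟩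
      have hind : (G.induce W).IsIndContained G := ⟨Embedding.induce W⟩
      refine ih (Nat.card W) ?_ hWconn (fun i hi h => hbones i hi (h.trans hind))
        (fun h => hstar (h.trans hind)) rfl
      rw [← hc, Nat.card_coe_set_eq]
      exact Set.ncard_lt_card hW
    -- The smallest `S` is what `IsMinScattering.exists_three_adj` requires.
    obtain ⟨S, ⟨Y, hS⟩, hSmin⟩ := Set.exists_min_image
      {S | ∃ Y, G.IsMinScattering K S Y} Set.ncard (Set.toFinite _) ⟨S₀, Y₀, hmin⟩
    obtain ⟨X, hX, hXlt⟩ := hS.exists_isBranchSet fun S' Y' h => hSmin S' ⟨Y', h⟩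
    have := hcore G X hX hbones hstar
    omega

end SimpleGraph

open SimpleGraph in
theorem theorem1p4 (m : ℕ) (hm : 3 ≤ m) (hmodd : Odd m)
    (A : Set ℕ) (hAodd : ∀ a ∈ A, Odd a)
    (hA : ∀ p ∈ A, ∀ q ∈ A, m ≤ p → m ≤ q → p + q + 1 ∉ A ∧ p + q - 1 ∉ A)
    (n : ℕ) (hn : 3 < n)
    {V : Type*} [Finite V] (G : SimpleGraph V)
    (hG : G.AdmitsOnlyBones A) (hα : G.localIndepNum < n) :
    (G.deficiency : ℤ) ≤ m * ((n : ℤ) - 3) * ((n : ℤ) - 2) ^ ((m - 3) / 2) + 1 ∧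
      (m = 3 → (G.deficiency : ℤ) ≤ 2 * (n : ℤ) - 5) := by
  obtain ⟨k, rfl⟩ := hmodd
  obtain ⟨N, rfl⟩ := Nat.exists_eq_add_of_le' (show 2 ≤ n by omega)
  have hstar : ¬ (completeBipartiteGraph (Fin 1) (Fin (N + 2))).IsIndContained G := by
    intro h
    -- Star sizes are bounded by |V|, so the `sSup` is not the default value 0.
    refine absurd (le_csSup ⟨Nat.card V, ?_⟩ h) (not_le.2 hα)
    rintro t ⟨φ⟩
    have := Nat.card_le_card_of_injective _ φ.injective
    simp at this
    omega
  have hN : ((N + 2 : ℕ) : ℤ) - 3 = ((N - 1 : ℕ) : ℤ) := by push_cast; omega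
  have hN' : ((N + 2 : ℕ) : ℤ) - 2 = (N : ℤ) := by push_cast; omega
  rw [hN, hN', show (2 * k + 1 - 3) / 2 = k - 1 by omega]
  rcases (show 1 ≤ k by omega).eq_or_lt with rfl | hk
  · have h : G.deficiency ≤ 2 * N - 1 := by
      refine ScatteringLE.deficiency_le (by omega) (scatteringLE_of_isBranchSet (by omega) hAodd
        (fun G X hX hbones hstar => ?_) hG.1 hG.2 hstar)
      exact hX.ncard_compl_le_of_three hbones (by simpa using hA) (by omega)
        (fun x hx => Nat.le_of_lt_succ (hX.ncard_neighborSet_lt hstar hx))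
    simp only [Nat.sub_self, pow_zero, mul_one]
    push_cast
    omega
  · refine ⟨?_, by omega⟩
    have h : G.deficiency ≤ (2 * k + 1) * (N - 1) * N ^ (k - 1) + 1 := by
      refine ScatteringLE.deficiency_le (by omega) (scatteringLE_of_isBranchSet (by omega) hAodd
        (fun G X hX hbones hstar => ?_) hG.1 hG.2 hstar)
      exact hX.ncard_compl_le_of_two_le hk hbones hA (by omega)
        (fun x hx => Nat.le_of_lt_succ (hX.ncard_neighborSet_lt hstar hx))
    exact_mod_cast h
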